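/- **Setting.** An instance $I$ of the Stable Marriage problem with Incomplete lists (SMI) consists of a finite set $U$ of men and a finite set $W$ of women, where each man (woman) ranks a subset of the women (men) in strict preference order. $\operatorname{rank}(x,y)\ge 1$ is the position of $y$ on the list of $x$. A pair $(m,w)$ is acceptable if each of $m,w$ is on the other's list. A matching $M$ is a set of acceptable pairs in which nobody occurs twice; $M(x)$ is the partner of $x$. An acceptable pair $(m,w)$ blocks $M$ if $m$ is unassigned or prefers $w$ to $M(m)$, and $w$ is unassigned or prefers $m$ to $M(w)$; $M$ is stable if no pair blocks it. Let $d_U(M)=\max_m \operatorname{rank}(m,M(m))$ over the men assigned in $M$, $d_W(M)=\max_w\operatorname{rank}(w,M(w))$ over the women assigned in $M$ (a maximum over the empty set is $0$), and $r(M)=|d_U(M)-d_W(M)|$. A stable matching is *regret-equal* if it minimises $r$ over all stable matchings of $I$. **Rotations.** Let $M_0$ and $M_z$ be the results of the man-oriented and of the woman-oriented Gale–Shapley algorithm. For a stable matching $M$ and a man $m$ assigned in $M$, let $s(m,M)$ be the first woman $w$ after $M(m)$ on $m$'s list such that $(m,w)$ is acceptable and $w$ is unassigned in $M$ or prefers $m$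 to $M(w)$ (if there is one). A rotation exposed on $M$ is a cyclic sequence of distinct pairs $\rho=\{(m_1,w_1),\dots,(m_q,w_q)\}\subseteq M$ with $s(m_i,M)=w_{i+1}$ for all $i$ (indices modulo $q$). Eliminating $\rho$ from $M$ replaces the pairs of $\rho$ by the pairs $(m_i,w_{i+1})$. Let $R$ be the set of all rotations exposed on stable matchings of $I$. A rotation $\rho$ precedes $\tau$ if in every sequence of eliminations starting from $M_0$, $\tau$ is not exposed until $\rho$ has been eliminated. The closure $c(S)$ of $S\subseteq R$ consists of $S$ and all rotations preceding an element of $S$. $M/Q'$ is the matching obtained from $M$ by eliminating the rotations in $Q'$, each once, in an order in which this is possible. $\phi(m,w)$ is the unique rotation containing $(m,w)$, and $R_j(M)$ is the set of the rotations that contain a pair $(M(w),w)$ with $\operatorname{rank}(w,M(w))=j$. **Algorithm REDI.** If $d_U(M_0)\ge d_W(M_0)$, return $M_0$. Otherwise set $M_{opt}\gets M_0$, then $M_{opt}\gets\mathrm{COL}(M_0,\emptyset,M_{opt})$, and return $M_{opt}$ if $r(M_{opt})=0$. Then, for each man $m_i$ (in any order): set $M\gets M_0$, $Q\gets\emptyset$,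 and while $m_i$ is assigned in $M$, $(m_i,M(m_i))\notin M_z$ and $d_U(M)<d_W(M)$, do the following: let $a\gets d_U(M)$, $Q'\gets c(\{\phi(m_i,M(m_i))\})\setminus Q$, $M\gets M/Q'$, $Q\gets Q\cup Q'$; if now $d_U(M)>a$ and $\operatorname{rank}(m_i,M(m_i))=d_U(M)$, set $M_{opt}\gets \mathrm{COL}(M,Q,M_{opt})$ and return $M_{opt}$ if $r(M_{opt})=0$. After all men have been treated, return $M_{opt}$. Subroutine $\mathrm{COL}(M,Q,M_{opt})$ (local variables): let $a\gets d_U(M)$ and repeat: if $r(M)<r(M_{opt})$, set $M_{opt}\gets M$; if $d_U(M)\ge d_W(M)$, return $M_{opt}$; let $b\gets d_W(M)$ and $Q'\gets c(R_b(M))\setminus Q$; if $d_U(M/Q')>a$ or $d_W(M/Q')=b$, return $M_{opt}$; otherwise set $M\gets M/Q'$, $Q\gets Q\cup Q'$. **Theorem (correctness of Algorithm REDI).** For every instance $I$ of SMI, every execution of Algorithm REDI on $I$ terminates without getting stuck (so all the objects it refers to exist) and outputs a regret-equal stable matching of $I$: the output is stable and minimises $|d_U(M)-d_W(M)|$ over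 all stable matchings $M$ of $I$. -/

import Mathlib

/-- An instance of the Stable Marriage problem with Incomplete lists: every man (woman) ranks a
subset of the women (men) in strict order, most preferred first. -/
structure SMI (U W : Type*) where
  /-- the preference list of a man -/
  manList : U → List W
  /-- the preference list of a woman -/
  womanList : W → List U
  manList_nodup : ∀ m, (manList m).Nodup
  womanList_nodup : ∀ w, (womanList w).Nodup

namespace SMI

variable {U W : Type*} [Fintype U] [Fintype W] [DecidableEq U] [DecidableEq W]

/-- The instance with the roles of men and women exchanged. -/
def swap {U W : Type*} (I : SMI U W) : SMI W U where
  manList := I.womanList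
  womanList := I.manList
  manList_nodup := I.womanList_nodup
  womanList_nodup := I.manList_nodup

/-- `I.rankU m w` is the location (starting from 1) of the woman `w` on the list of `m`. -/
def rankU (I : SMI U W) (m : U) (w : W) : ℕ := (I.manList m).idxOf w + 1

/-- `I.rankW w m` is the location (starting from 1) of the man `m` on the list of `w`. -/
def rankW (I : SMI U W) (w : W) (m : U) : ℕ := (I.womanList w).idxOf m + 1

/-- `(m, w)` is an acceptable pair: each of the two appears on the list of the other. -/
def Acceptable (I : SMI U W) (m : U) (w : W) : Prop :=
  w ∈ I.manList m ∧ m ∈ I.womanList w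

/-- A matching, as a set of man-woman pairs. -/
structure IsMatching (I : SMI U W) (M : Finset (U × W)) : Prop where
  acceptable : ∀ m w, (m, w) ∈ M → I.Acceptable m w
  man_unique : ∀ m w w', (m, w) ∈ M → (m, w') ∈ M → w = w'
  woman_unique : ∀ m m' w, (m, w) ∈ M → (m', w) ∈ M → m = m'

/-- `m` is unassigned in `M` or prefers `w` to his partner (for `w` on the list of `m`). -/
def ManWould (I : SMI U W) (M : Finset (U × W)) (m : U) (w : W) : Prop :=
  ∀ w', (m, w') ∈ M → I.rankU m w < I.rankU m w'

/-- `w` is unassigned in `M` or prefers `m` to her partner (for `m` on the list of `w`). -/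
def WomanWould (I : SMI U W) (M : Finset (U × W)) (w : W) (m : U) : Prop :=
  ∀ m', (m', w) ∈ M → I.rankW w m < I.rankW w m'

/-- `(m, w)` is a blocking pair of `M`. -/
def Blocks (I : SMI U W) (M : Finset (U × W)) (m : U) (w : W) : Prop :=
  I.Acceptable m w ∧ I.ManWould M m w ∧ I.WomanWould M w m

/-- `M` is a stable matching. -/
def IsStable (I : SMI U W) (M : Finset (U × W)) : Prop :=
  I.IsMatching M ∧ ∀ m w, ¬ I.Blocks M m w

/-- The man-degree: the largest rank of the partner of an assigned man. -/
def dU (I : SMI U W) (M : Finset (U × W)) : ℕ := M.sup fun p => I.rankU p.1 p.2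

/-- The woman-degree: the largest rank of the partner of an assigned woman. -/
def dW (I : SMI U W) (M : Finset (U × W)) : ℕ := M.sup fun p => I.rankW p.2 p.1

/-- The regret-equality score. -/
def regret (I : SMI U W) (M : Finset (U × W)) : ℤ := |(I.dU M : ℤ) - (I.dW M : ℤ)|

/-- `M` is a regret-equal stable matching: it is stable and minimises the regret-equality score
over all stable matchings. -/
def IsRegretEqual (I : SMI U W) (M : Finset (U × W)) : Prop :=
  I.IsStable M ∧ ∀ M', I.IsStable M' → I.regret M ≤ I.regret M'

/-! ### The Gale-Shapley algorithm, in rounds -/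

open Classical in
/-- The proposals of one round: every man proposes to the first woman on his list who has not
rejected him; `X` is the set of rejections so far. -/
noncomputable def proposals (I : SMI U W) (X : Finset (U × W)) : Finset (U × W) :=
  Finset.univ.filter fun p => p.2 ∈ I.manList p.1 ∧ p ∉ X ∧
    ∀ w, w ∈ I.manList p.1 → (p.1, w) ∉ X → I.rankU p.1 p.2 ≤ I.rankU p.1 w

open Classical in
/-- One round: every woman rejects the proposers who are not on her list and all proposers except
the one whom she likes best. -/
noncomputable def round (I : SMI U W) (X : Finset (U × W)) : Finset (U × W) :=
  X ∪ (I.proposals X).filter fun p => p.1 ∉ I.womanList p.2 ∨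
    ∃ m, (m, p.2) ∈ I.proposals X ∧ m ∈ I.womanList p.2 ∧ I.rankW p.2 m < I.rankW p.2 p.1

/-- The result of the Man-oriented Gale-Shapley Algorithm. Every round in which the process has not
stopped adds a rejection, so `|U × W|` rounds are enough. -/
noncomputable def mgs (I : SMI U W) : Finset (U × W) :=
  I.proposals (I.round^[Fintype.card (U × W)] ∅)

/-- The result of the Woman-oriented Gale-Shapley Algorithm. -/
noncomputable def wgs (I : SMI U W) : Finset (U × W) :=
  I.swap.mgs.image Prod.swap

/-! ### Rotations -/

/-- `w` would leave her state in `M` for `m`, and comes after the partner of `m` in `M` on the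
list of `m`. -/
def IsLater (I : SMI U W) (M : Finset (U × W)) (m : U) (w : W) : Prop :=
  I.Acceptable m w ∧ (∃ w₀, (m, w₀) ∈ M ∧ I.rankU m w₀ < I.rankU m w) ∧ I.WomanWould M w m

/-- `w = s(m, M)`: the first woman after `M(m)` on the list of `m` who would leave her state in `M`
for `m`. -/
def IsNext (I : SMI U W) (M : Finset (U × W)) (m : U) (w : W) : Prop :=
  I.IsLater M m w ∧ ∀ w', I.IsLater M m w' → I.rankU m w ≤ I.rankU m w'

/-- `p 0, …, p q` is, in this cyclic order, a rotation exposed on `M`: distinct pairs of `M` such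
that `s(m, M)`, for the man `m` of each pair, is the woman of the next pair (cyclically; addition
in `Fin (q + 1)` is modulo `q + 1`). As `M` is a matching, this says that the man of the next pair
is `M(s(m, M))`. -/
def IsRotationSeq (I : SMI U W) (M : Finset (U × W)) {q : ℕ} (p : Fin (q + 1) → U × W) : Prop :=
  Function.Injective p ∧ ∀ i, p i ∈ M ∧ I.IsNext M (p i).1 (p (i + 1)).2

/-- The rotation `ρ`, given as a set of pairs, is exposed on the stable matching `M`, and `M'` is
the result of eliminating it: the pairs of `ρ` are removed, and every man of `ρ` is assigned to the
woman of the next pair. -/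
def Eliminates (I : SMI U W) (M ρ M' : Finset (U × W)) : Prop :=
  I.IsStable M ∧ ∃ (q : ℕ) (p : Fin (q + 1) → U × W), I.IsRotationSeq M p ∧
    ρ = Finset.univ.image p ∧
    M' = (M \ ρ) ∪ Finset.univ.image fun i => ((p i).1, (p (i + 1)).2)

/-- The rotation `ρ` is exposed on the stable matching `M`. -/
def Exposed (I : SMI U W) (M ρ : Finset (U × W)) : Prop :=
  I.IsStable M ∧ ∃ (q : ℕ) (p : Fin (q + 1) → U × W), I.IsRotationSeq M p ∧
    ρ = Finset.univ.image p

/-- The set `R` of all rotations of the instance. -/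
def rotations (I : SMI U W) : Set (Finset (U × W)) := {ρ | ∃ M, I.Exposed M ρ}

/-- `M'` is obtained from `M` by eliminating the rotations in the list one after the other. -/
inductive EliminatesList (I : SMI U W) :
    Finset (U × W) → List (Finset (U × W)) → Finset (U × W) → Prop
  | nil (M : Finset (U × W)) : EliminatesList I M [] M
  | cons {M ρ M' M'' : Finset (U × W)} {l : List (Finset (U × W))} :
      I.Eliminates M ρ M' → EliminatesList I M' l M'' → EliminatesList I M (ρ :: l) M''

/-- `M' = M / Q`: the rotations in the set `Q` are eliminated, each of them once, in some order in
which this is possible. -/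
def EliminatesSet (I : SMI U W) (M : Finset (U × W)) (Q : Set (Finset (U × W)))
    (M' : Finset (U × W)) : Prop :=
  ∃ l : List (Finset (U × W)), l.Nodup ∧ (∀ ρ, ρ ∈ l ↔ ρ ∈ Q) ∧ I.EliminatesList M l M'

/-- The rotation `ρ` precedes the rotation `τ`: starting from the man-optimal stable matching, `τ`
is not exposed until `ρ` has been eliminated. -/
def Precedes (I : SMI U W) (ρ τ : Finset (U × W)) : Prop :=
  ρ ∈ I.rotations ∧ τ ∈ I.rotations ∧
    ∀ l M, I.EliminatesList I.mgs l M → I.Exposed M τ → ρ ∈ l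

/-- The closure `c(S)` of a set of rotations in the rotation poset. -/
def rotClosure (I : SMI U W) (S : Set (Finset (U × W))) : Set (Finset (U × W)) :=
  {ρ | ρ ∈ S ∨ ∃ τ ∈ S, I.Precedes ρ τ}

/-- `ρ = φ(m, w)`: `ρ` is the unique rotation containing the pair `(m, w)`. -/
def IsPhi (I : SMI U W) (m : U) (w : W) (ρ : Finset (U × W)) : Prop :=
  ρ ∈ I.rotations ∧ (m, w) ∈ ρ ∧ ∀ ρ' ∈ I.rotations, (m, w) ∈ ρ' → ρ' = ρ

/-- `R_j(M)`: the rotations that contain a pair `(M(w), w)` for which the rank of `M(w)` on the list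
of `w` is `j`. -/
def rotationsAt (I : SMI U W) (M : Finset (U × W)) (j : ℕ) : Set (Finset (U × W)) :=
  {σ | σ ∈ I.rotations ∧ ∃ m w, (m, w) ∈ σ ∧ (m, w) ∈ M ∧ I.rankW w m = j}

/-! ### Algorithm REDI as a transition system -/

/-- Where a call of the column operation returns to: the call for the first column, or the call
inside the while loop for the man `m` with local variables `M` and `Q`, where `todo` is the set of
men whom the for loop still has to treat. -/
inductive Frame (U W : Type*)
  | first : Frame U W
  | inner (todo : Finset U) (m : U) (M : Finset (U × W)) (Q : Set (Finset (U × W))) : Frame U W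

/-- The states of an execution. -/
inductive State (U W : Type*)
  /-- the beginning -/
  | start : State U W
  /-- the head of the loop of the column operation, with its local variables -/
  | col (k : Frame U W) (a : ℕ) (M : Finset (U × W)) (Q : Set (Finset (U × W)))
      (Mopt : Finset (U × W)) : State U W
  /-- just after a call of the column operation -/
  | colRet (k : Frame U W) (Mopt : Finset (U × W)) : State U W
  /-- the head of the for loop -/
  | forLoop (todo : Finset U) (Mopt : Finset (U × W)) : State U W
  /-- the head of the while loop for the man `m` -/
  | whileLoop (todo : Finset U) (m : U) (M : Finset (U × W)) (Q : Set (Finset (U × W)))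
      (Mopt : Finset (U × W)) : State U W
  /-- the algorithm has returned `M` -/
  | output (M : Finset (U × W)) : State U W

open Classical in
/-- `if r(M) < r(Mopt) then Mopt ← M` -/
noncomputable def better (I : SMI U W) (M Mopt : Finset (U × W)) : Finset (U × W) :=
  if I.regret M < I.regret Mopt then M else Mopt

/-- The condition of the while loop: `(m, M(m)) ∉ M_z` and `d_U(M) < d_W(M)`. -/
def Guard (I : SMI U W) (m : U) (M : Finset (U × W)) : Prop :=
  (∃ w, (m, w) ∈ M ∧ (m, w) ∉ I.wgs) ∧ I.dU M < I.dW M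

/-- The test before a column operation: the men's degree has increased from `a` to `d_U(M)`, and
`m` is a worst ranked man in `M`. -/
def NewColumn (I : SMI U W) (a : ℕ) (m : U) (M : Finset (U × W)) : Prop :=
  a < I.dU M ∧ ∃ w, (m, w) ∈ M ∧ I.rankU m w = I.dU M

/-- The transitions of Algorithm REDI. -/
inductive Step (I : SMI U W) : State U W → State U W → Prop
  -- `if d_U(M_0) ≥ d_W(M_0) then return M_0`, else `Mopt ← M_0` and call REDI-COL
  | start_return : I.dW I.mgs ≤ I.dU I.mgs → Step I .start (.output I.mgs)
  | start_col : I.dU I.mgs < I.dW I.mgs →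
      Step I .start (.col .first (I.dU I.mgs) I.mgs ∅ I.mgs)
  -- the body of the loop of REDI-COL
  | col_stop (k : Frame U W) (a : ℕ) (M : Finset (U × W)) (Q : Set (Finset (U × W)))
      (Mopt : Finset (U × W)) :
      I.dW M ≤ I.dU M → Step I (.col k a M Q Mopt) (.colRet k (I.better M Mopt))
  | col_reject (k : Frame U W) (a : ℕ) (M : Finset (U × W)) (Q : Set (Finset (U × W)))
      (Mopt M' : Finset (U × W)) :
      I.dU M < I.dW M →
      I.EliminatesSet M (I.rotClosure (I.rotationsAt M (I.dW M)) \ Q) M' →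
      (a < I.dU M' ∨ I.dW M' = I.dW M) →
      Step I (.col k a M Q Mopt) (.colRet k (I.better M Mopt))
  | col_accept (k : Frame U W) (a : ℕ) (M : Finset (U × W)) (Q : Set (Finset (U × W)))
      (Mopt M' : Finset (U × W)) :
      I.dU M < I.dW M →
      I.EliminatesSet M (I.rotClosure (I.rotationsAt M (I.dW M)) \ Q) M' →
      ¬ (a < I.dU M' ∨ I.dW M' = I.dW M) →
      Step I (.col k a M Q Mopt)
        (.col k a M' (Q ∪ (I.rotClosure (I.rotationsAt M (I.dW M)) \ Q)) (I.better M Mopt))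
  -- after REDI-COL: `if r(Mopt) = 0 then return Mopt`, else go on
  | ret_return (k : Frame U W) (Mopt : Finset (U × W)) :
      I.regret Mopt = 0 → Step I (.colRet k Mopt) (.output Mopt)
  | ret_first (Mopt : Finset (U × W)) :
      I.regret Mopt ≠ 0 → Step I (.colRet .first Mopt) (.forLoop Finset.univ Mopt)
  | ret_inner (todo : Finset U) (m : U) (M : Finset (U × W)) (Q : Set (Finset (U × W)))
      (Mopt : Finset (U × W)) :
      I.regret Mopt ≠ 0 →
      Step I (.colRet (.inner todo m M Q) Mopt) (.whileLoop todo m M Q Mopt)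
  -- the for loop, in any order of the men: `M ← M_0`, `Q ← ∅`; after the loop `return Mopt`
  | for_end (Mopt : Finset (U × W)) : Step I (.forLoop ∅ Mopt) (.output Mopt)
  | for_next (todo : Finset U) (m : U) (Mopt : Finset (U × W)) :
      m ∈ todo → Step I (.forLoop todo Mopt) (.whileLoop (todo.erase m) m I.mgs ∅ Mopt)
  -- the while loop
  | while_end (todo : Finset U) (m : U) (M : Finset (U × W)) (Q : Set (Finset (U × W)))
      (Mopt : Finset (U × W)) :
      ¬ I.Guard m M → Step I (.whileLoop todo m M Q Mopt) (.forLoop todo Mopt)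
  | while_col (todo : Finset U) (m : U) (w : W) (ρ M : Finset (U × W))
      (Q : Set (Finset (U × W))) (Mopt M' : Finset (U × W)) :
      I.Guard m M → (m, w) ∈ M → I.IsPhi m w ρ →
      I.EliminatesSet M (I.rotClosure {ρ} \ Q) M' → I.NewColumn (I.dU M) m M' →
      Step I (.whileLoop todo m M Q Mopt)
        (.col (.inner todo m M' (Q ∪ (I.rotClosure {ρ} \ Q))) (I.dU M') M'
          (Q ∪ (I.rotClosure {ρ} \ Q)) Mopt)
  | while_skip (todo : Finset U) (m : U) (w : W) (ρ M : Finset (U × W))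
      (Q : Set (Finset (U × W))) (Mopt M' : Finset (U × W)) :
      I.Guard m M → (m, w) ∈ M → I.IsPhi m w ρ →
      I.EliminatesSet M (I.rotClosure {ρ} \ Q) M' → ¬ I.NewColumn (I.dU M) m M' →
      Step I (.whileLoop todo m M Q Mopt)
        (.whileLoop todo m M' (Q ∪ (I.rotClosure {ρ} \ Q)) Mopt)

/-- The state `s` occurs in some execution of Algorithm REDI. -/
def Reachable (I : SMI U W) (s : State U W) : Prop :=
  Relation.ReflTransGen I.Step .start s

end SMI

namespace SMI

set_option linter.unusedSectionVars false

variable {U W : Type*} [Fintype U] [Fintype W] [DecidableEq U] [DecidableEq W]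
variable {I : SMI U W} {M M' N : Finset (U × W)} {m m' : U} {w w' : W}

/-! ### Ranks and partners -/

/-! A stable matching `M` is encoded by `past M`, the set of rotations all of whose men are worse
off in `M`. Domination becomes inclusion of these sets (`Dom.past_subset`, `dom_of_past_subset`),
and eliminating a rotation adds exactly that rotation (`Eliminates.past_eq`). Past sets are closed
under the precedence order and under intersection and union, and the closure of one rotation is the
least past set containing it. So if `Q = past M`, then `M/(c(S) \ Q)` exists and its past set is
`past M ∪ c(S)`; this is why the algorithm never gets stuck.

For optimality, fix a target `K`: a stable matching of minimal regret with the fewest past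
rotations. Down the lattice `dU` grows and `dW` shrinks. Hence every stable matching strictly above
`K` has `dU < dW`; otherwise its regret would be at most that of `K` (`Dom.regret_le`). Both loops
may therefore continue until they reach `K`. Let `N` be a highest stable matching above `K` with `dU
N = dU K`.

If `dU K` is already the man-degree of `M_0`, the first column operation starts in the right column.
Otherwise take a man `m` of worst rank in `N`. Until `m` has his partner in `N`, the rotation he is
in belongs to `past N`, so his while loop stays above `N`. When he gets that partner, the man-degree
becomes `dU N`, and it has just increased because everything strictly above `N` has smaller
man-degree; so a column operation is called (`IsTarget.while_step`). Inside this column, a matching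
`M ≠ K` above `K` has `dW K < dW M`, so the worst-off women all change partner on the way to `K`.
The rotations chosen by the algorithm then lie in `past K`, the step is accepted, and `K` is
eventually met (`IsTarget.col_step`). The invariant `Inv` records that this search has succeeded or
is still ahead. Termination follows from a lexicographic measure. -/

theorem rankU_injOn (hw : w ∈ I.manList m) (h : I.rankU m w = I.rankU m w') : w = w' := by
  unfold rankU at h
  exact (List.idxOf_inj hw).1 (by omega)

theorem rankW_injOn (hm : m ∈ I.womanList w) (h : I.rankW w m = I.rankW w m') : m = m' := by
  unfold rankW at h
  exact (List.idxOf_inj hm).1 (by omega)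

theorem IsMatching.mem_of_rankU_eq (hM : I.IsMatching M) (h : (m, w) ∈ M)
    (hr : I.rankU m w = I.rankU m w') : (m, w') ∈ M :=
  rankU_injOn (hM.acceptable m w h).1 hr ▸ h

/-! ### Opposition of interests -/

/-- If `m` prefers his partner in `M` to his state in `M'`, then this partner prefers `M'`. -/
theorem exists_woman_improves (hM : I.IsMatching M) (hM' : I.IsStable M') (h : (m, w) ∈ M)
    (hm : I.ManWould M' m w) : ∃ m', (m', w) ∈ M' ∧ I.WomanWould M w m' := by
  have hb := hM'.2 m w
  have ha := hM.acceptable m w h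
  simp only [Blocks, ha, hm, true_and, WomanWould, not_forall, not_lt] at hb
  obtain ⟨m', h', hle⟩ := hb
  refine ⟨m', h', fun m'' h'' => ?_⟩
  obtain rfl := hM.woman_unique _ _ _ h h''
  refine lt_of_le_of_ne hle fun he => ?_
  obtain rfl := rankW_injOn (hM'.1.acceptable _ _ h').2 he
  exact (hm w h').ne rfl

/-- If `w` prefers her partner in `M'` to her state in `M`, then this partner prefers `M`. -/
theorem exists_man_prefers (hM : I.IsStable M) (hM' : I.IsMatching M') (h : (m, w) ∈ M')
    (hw : I.WomanWould M w m) : ∃ w', (m, w') ∈ M ∧ I.ManWould M' m w' := by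
  have hb := hM.2 m w
  have ha := hM'.acceptable m w h
  simp only [Blocks, ha, hw, true_and, and_true, ManWould, not_forall, not_lt] at hb
  obtain ⟨w', h', hle⟩ := hb
  refine ⟨w', h', fun w'' h'' => ?_⟩
  obtain rfl := hM'.man_unique _ _ _ h h''
  refine lt_of_le_of_ne hle fun he => ?_
  obtain rfl := rankU_injOn (hM.1.acceptable _ _ h').1 he
  exact (hw m h').ne rfl

-- Counting closes a cycle of inequalities. The women of `P` are among those of `T`, and the men of
-- `T` are among those of `P`. In a matching, a set of pairs has as many men as women, so both
-- inclusions are equalities.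
open Classical in
theorem opposition_image_eq (hM : I.IsStable M) (hM' : I.IsStable M') :
    (M.filter fun p => I.ManWould M' p.1 p.2).image Prod.fst =
        (M'.filter fun p => I.WomanWould M p.2 p.1).image Prod.fst ∧
      (M.filter fun p => I.ManWould M' p.1 p.2).image Prod.snd =
        (M'.filter fun p => I.WomanWould M p.2 p.1).image Prod.snd := by
  set P := M.filter fun p => I.ManWould M' p.1 p.2 with hP
  set T := M'.filter fun p => I.WomanWould M p.2 p.1 with hT
  have h1 : P.image Prod.snd ⊆ T.image Prod.snd := by
    intro w hw
    obtain ⟨⟨m, w⟩, hp, rfl⟩ := Finset.mem_image.1 hw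
    obtain ⟨hp, hp'⟩ := Finset.mem_filter.1 hp
    obtain ⟨m', h, h'⟩ := exists_woman_improves hM.1 hM' hp hp'
    exact Finset.mem_image.2 ⟨(m', w), Finset.mem_filter.2 ⟨h, h'⟩, rfl⟩
  have h2 : T.image Prod.fst ⊆ P.image Prod.fst := by
    intro m hm
    obtain ⟨⟨m, w⟩, hp, rfl⟩ := Finset.mem_image.1 hm
    obtain ⟨hp, hp'⟩ := Finset.mem_filter.1 hp
    obtain ⟨w', h, h'⟩ := exists_man_prefers hM hM'.1 hp hp'
    exact Finset.mem_image.2 ⟨(m, w'), Finset.mem_filter.2 ⟨h, h'⟩, rfl⟩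
  have cf : ∀ {K S : Finset (U × W)}, I.IsMatching K → S ⊆ K →
      (S.image Prod.fst).card = S.card := fun hK hS => by
    refine Finset.card_image_of_injOn ?_
    rintro ⟨a, b⟩ ha ⟨c, d⟩ hc (rfl : a = c)
    rw [hK.man_unique _ _ _ (hS ha) (hS hc)]
  have cs : ∀ {K S : Finset (U × W)}, I.IsMatching K → S ⊆ K →
      (S.image Prod.snd).card = S.card := fun hK hS => by
    refine Finset.card_image_of_injOn ?_
    rintro ⟨a, b⟩ ha ⟨c, d⟩ hc (rfl : b = d)
    rw [hK.woman_unique _ _ _ (hS ha) (hS hc)]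
  have hPM : P ⊆ M := Finset.filter_subset _ _
  have hTM : T ⊆ M' := Finset.filter_subset _ _
  have e1 := Finset.card_le_card h1
  have e2 := Finset.card_le_card h2
  rw [cs hM.1 hPM, cs hM'.1 hTM] at e1
  rw [cf hM.1 hPM, cf hM'.1 hTM] at e2
  refine ⟨(Finset.eq_of_subset_of_card_le h2 ?_).symm, Finset.eq_of_subset_of_card_le h1 ?_⟩
  · rw [cf hM.1 hPM, cf hM'.1 hTM]; exact e1
  · rw [cs hM.1 hPM, cs hM'.1 hTM]; exact e2

/-- If `m` prefers `M` to `M'`, then he has a partner in `M'`, who prefers `M'`. -/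
theorem exists_partner_improves (hM : I.IsStable M) (hM' : I.IsStable M') (h : (m, w) ∈ M)
    (hm : I.ManWould M' m w) : ∃ w', (m, w') ∈ M' ∧ I.WomanWould M w' m := by
  classical
  have hmem : m ∈ (M.filter fun p => I.ManWould M' p.1 p.2).image Prod.fst :=
    Finset.mem_image.2 ⟨(m, w), Finset.mem_filter.2 ⟨h, hm⟩, rfl⟩
  rw [(opposition_image_eq hM hM').1] at hmem
  obtain ⟨⟨m, w'⟩, hp, rfl⟩ := Finset.mem_image.1 hmem
  exact ⟨w', Finset.mem_filter.1 hp⟩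

/-- If `w` prefers `M'` to `M`, then she has a partner in `M`, who prefers `M`. -/
theorem exists_partner_prefers (hM : I.IsStable M) (hM' : I.IsStable M') (h : (m, w) ∈ M')
    (hw : I.WomanWould M w m) : ∃ m', (m', w) ∈ M ∧ I.ManWould M' m' w := by
  classical
  have hmem : w ∈ (M'.filter fun p => I.WomanWould M p.2 p.1).image Prod.snd :=
    Finset.mem_image.2 ⟨(m, w), Finset.mem_filter.2 ⟨h, hw⟩, rfl⟩
  rw [← (opposition_image_eq hM hM').2] at hmem
  obtain ⟨⟨m', w⟩, hp, rfl⟩ := Finset.mem_image.1 hmem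
  exact ⟨m', Finset.mem_filter.1 hp⟩

/-- All stable matchings assign the same men. -/
theorem IsStable.man_assigned (hM : I.IsStable M) (hM' : I.IsStable M') (h : (m, w) ∈ M) :
    ∃ w', (m, w') ∈ M' := by
  by_contra! hn
  obtain ⟨w', h', -⟩ := exists_partner_improves hM hM' h fun w' h' => (hn w' h').elim
  exact hn w' h'

/-- All stable matchings assign the same women. -/
theorem IsStable.woman_assigned (hM : I.IsStable M) (hM' : I.IsStable M') (h : (m, w) ∈ M) :
    ∃ m', (m', w) ∈ M' := by
  by_contra! hn
  obtain ⟨m', h', -⟩ := exists_partner_prefers hM' hM h fun m' h' => (hn m' h').elim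
  exact hn m' h'

/-! ### Dominance and the lattice operations -/

/-- Every man weakly prefers `M` to `M'`. -/
def Dom (I : SMI U W) (M M' : Finset (U × W)) : Prop :=
  ∀ m w w', (m, w) ∈ M → (m, w') ∈ M' → I.rankU m w ≤ I.rankU m w'

theorem IsMatching.manWould_of_lt (hM : I.IsMatching M) (h : (m, w') ∈ M)
    (hlt : I.rankU m w < I.rankU m w') : I.ManWould M m w := fun _ h' =>
  hM.man_unique _ _ _ h h' ▸ hlt

theorem IsMatching.womanWould_of_lt (hM : I.IsMatching M) (h : (m', w) ∈ M)
    (hlt : I.rankW w m < I.rankW w m') : I.WomanWould M w m := fun _ h' =>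
  hM.woman_unique _ _ _ h h' ▸ hlt

theorem Dom.trans (hN : I.IsStable N) (hM : I.IsStable M) (h : I.Dom M N) (h' : I.Dom N M') :
    I.Dom M M' := fun m w w' hw hw' => by
  obtain ⟨x, hx⟩ := hM.man_assigned hN hw
  exact (h _ _ _ hw hx).trans (h' _ _ _ hx hw')

theorem dom_of_women (hM : I.IsStable M) (hN : I.IsStable N)
    (h : ∀ m m' w, (m, w) ∈ M → (m', w) ∈ N → I.rankW w m' ≤ I.rankW w m) : I.Dom M N := by
  intro m w w' hw hw'
  by_contra! hlt
  obtain ⟨m', h1, h2⟩ := exists_woman_improves hN.1 hM hw' (hM.1.manWould_of_lt hw hlt)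
  exact absurd (h2 _ hw') (h _ _ _ h1 hw').not_gt

theorem Dom.women (hM : I.IsStable M) (hN : I.IsStable N) (h : I.Dom M N)
    (hw : (m, w) ∈ M) (hw' : (m', w) ∈ N) : I.rankW w m' ≤ I.rankW w m := by
  by_contra! hlt
  obtain ⟨x, h1, h2⟩ := exists_man_prefers hN hM.1 hw (hN.1.womanWould_of_lt hw' hlt)
  exact absurd (h2 _ hw) (h _ _ _ hw h1).not_gt

theorem Dom.antisymm (hM : I.IsStable M) (hN : I.IsStable N) (h : I.Dom M N) (h' : I.Dom N M) :
    M = N := by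
  have key : ∀ {A B : Finset (U × W)}, I.IsStable A → I.IsStable B → I.Dom A B → I.Dom B A →
      A ⊆ B := by
    rintro A B hA hB h h' ⟨m, w⟩ hw
    obtain ⟨w', hw'⟩ := hA.man_assigned hB hw
    exact hB.1.mem_of_rankU_eq hw' ((h' _ _ _ hw' hw).antisymm (h _ _ _ hw hw'))
  exact (key hM hN h h').antisymm (key hN hM h' h)

/-- Every man takes the better of his two partners. -/
theorem IsStable.exists_join (hM : I.IsStable M) (hM' : I.IsStable M') :
    ∃ N, I.IsStable N ∧ I.Dom N M ∧ I.Dom N M' ∧ ∀ p ∈ N, p ∈ M ∨ p ∈ M' := by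
  classical
  set N := (M.filter fun p => ∀ x, (p.1, x) ∈ M' → I.rankU p.1 p.2 ≤ I.rankU p.1 x) ∪
    (M'.filter fun p => ∀ x, (p.1, x) ∈ M → I.rankU p.1 p.2 ≤ I.rankU p.1 x) with hN
  have mem : ∀ m w, (m, w) ∈ N ↔
      ((m, w) ∈ M ∧ ∀ x, (m, x) ∈ M' → I.rankU m w ≤ I.rankU m x) ∨
      ((m, w) ∈ M' ∧ ∀ x, (m, x) ∈ M → I.rankU m w ≤ I.rankU m x) := fun m w => by
    simp [hN]
  have d1 : I.Dom N M := by
    intro m w w' hw hw'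
    rcases (mem _ _).1 hw with ⟨h, -⟩ | ⟨-, h⟩
    · rw [hM.1.man_unique _ _ _ h hw']
    · exact h _ hw'
  have d2 : I.Dom N M' := by
    intro m w w' hw hw'
    rcases (mem _ _).1 hw with ⟨-, h⟩ | ⟨h, -⟩
    · exact h _ hw'
    · rw [hM'.1.man_unique _ _ _ h hw']
  have sub : ∀ p ∈ N, p ∈ M ∨ p ∈ M' := fun ⟨m, w⟩ h => by
    rcases (mem _ _).1 h with h | h
    exacts [Or.inl h.1, Or.inr h.1]
  have acc : ∀ m w, (m, w) ∈ N → I.Acceptable m w := fun m w h =>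
    (sub _ h).elim (hM.1.acceptable _ _) (hM'.1.acceptable _ _)
  -- If two different men claimed `w`, both would strictly prefer her to their other partner, and by
  -- opposition `w` would strictly prefer each of the two men to the other.
  have cross : ∀ {A B : Finset (U × W)}, I.IsStable A → I.IsStable B → ∀ {m m' w},
      (m, w) ∈ A → (∀ x, (m, x) ∈ B → I.rankU m w ≤ I.rankU m x) →
      (m', w) ∈ B → (∀ x, (m', x) ∈ A → I.rankU m' w ≤ I.rankU m' x) → m = m' := by
    intro A B hA hB m m' w h1 h2 h3 h4
    by_contra hne
    have hs : I.ManWould B m w := fun x hx => lt_of_le_of_ne (h2 x hx) fun he => hne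
      (hB.1.woman_unique _ _ _ (hB.1.mem_of_rankU_eq hx he.symm) h3)
    have hs' : I.ManWould A m' w := fun x hx => lt_of_le_of_ne (h4 x hx) fun he => hne
      (hA.1.woman_unique _ _ _ h1 (hA.1.mem_of_rankU_eq hx he.symm))
    obtain ⟨y, hy, hy'⟩ := exists_woman_improves hA.1 hB h1 hs
    obtain ⟨z, hz, hz'⟩ := exists_woman_improves hB.1 hA h3 hs'
    obtain rfl := hB.1.woman_unique _ _ _ hy h3
    obtain rfl := hA.1.woman_unique _ _ _ hz h1
    exact absurd (hy' _ h1) (hz' _ h3).not_gt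
  refine ⟨N, ⟨⟨acc, ?_, ?_⟩, ?_⟩, d1, d2, sub⟩
  · intro m w w' h h'
    refine rankU_injOn (acc _ _ h).1 (le_antisymm ?_ ?_)
    · exact (sub _ h').elim (d1 _ _ _ h) (d2 _ _ _ h)
    · exact (sub _ h).elim (d1 _ _ _ h') (d2 _ _ _ h')
  · intro m m' w h h'
    rcases (mem _ _).1 h with h | h <;> rcases (mem _ _).1 h' with h' | h'
    · exact hM.1.woman_unique _ _ _ h.1 h'.1
    · exact cross hM hM' h.1 h.2 h'.1 h'.2
    · exact cross hM' hM h.1 h.2 h'.1 h'.2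
    · exact hM'.1.woman_unique _ _ _ h.1 h'.1
  · rintro m w ⟨ha, hm, hw⟩
    have total : ∀ x, (m, x) ∈ M ∨ (m, x) ∈ M' → I.rankU m w < I.rankU m x := by
      intro x hx
      have h1 : ∃ y, (m, y) ∈ M := hx.elim (fun h => ⟨x, h⟩) (hM'.man_assigned hM)
      have h2 : ∃ y, (m, y) ∈ M' := hx.elim (hM.man_assigned hM') (fun h => ⟨x, h⟩)
      obtain ⟨y, hy⟩ := h1
      obtain ⟨z, hz⟩ := h2
      have : ∃ u, (m, u) ∈ N := by
        rcases le_total (I.rankU m y) (I.rankU m z) with hle | hle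
        · exact ⟨y, (mem _ _).2 (Or.inl ⟨hy, fun v hv => hM'.1.man_unique _ _ _ hz hv ▸ hle⟩)⟩
        · exact ⟨z, (mem _ _).2 (Or.inr ⟨hz, fun v hv => hM.1.man_unique _ _ _ hy hv ▸ hle⟩)⟩
      obtain ⟨u, hu⟩ := this
      exact (hm u hu).trans_le (hx.elim (d1 _ _ _ hu) (d2 _ _ _ hu))
    have hb := hM.2 m w
    simp only [Blocks, ha, true_and, not_and, WomanWould, not_forall, not_lt] at hb
    obtain ⟨x, hx, hxm⟩ := hb fun y hy => total y (Or.inl hy)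
    have hb' := hM'.2 m w
    simp only [Blocks, ha, true_and, not_and, WomanWould, not_forall, not_lt] at hb'
    obtain ⟨y, hy, hym⟩ := hb' fun y hy => total y (Or.inr hy)
    -- In both matchings `w` has a partner, `x` or `y`, at least as good for her as `m`. If she kept
    -- neither, both left her for a better woman, and opposition makes `w` strictly prefer `x` to
    -- `y` and `y` to `x`.
    by_cases hxN : (x, w) ∈ N
    · exact absurd (hw _ hxN) hxm.not_gt
    by_cases hyN : (y, w) ∈ N
    · exact absurd (hw _ hyN) hym.not_gt
    rw [mem] at hxN hyN
    push Not at hxN hyN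
    obtain ⟨u, hu, hu'⟩ := hxN.1 hx
    obtain ⟨v, hv, hv'⟩ := hyN.2 hy
    obtain ⟨y', h1, h2⟩ := exists_partner_improves hM' hM hu (hM.1.manWould_of_lt hx hu')
    obtain rfl := hM.1.man_unique _ _ _ h1 hx
    obtain ⟨x', h3, h4⟩ := exists_partner_improves hM hM' hv (hM'.1.manWould_of_lt hy hv')
    obtain rfl := hM'.1.man_unique _ _ _ h3 hy
    exact absurd (h2 _ hy) (h4 _ hx).not_gt

/-! ### Exchanging the roles of men and women -/

theorem mem_image_swap : (w, m) ∈ M.image Prod.swap ↔ (m, w) ∈ M := by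
  simp

theorem IsStable.swap (hM : I.IsStable M) : I.swap.IsStable (M.image Prod.swap) := by
  refine ⟨⟨fun w m h => (hM.1.acceptable m w (mem_image_swap.1 h)).symm,
    fun w m m' h h' => hM.1.woman_unique m m' w (mem_image_swap.1 h) (mem_image_swap.1 h'),
    fun w w' m h h' => hM.1.man_unique m w w' (mem_image_swap.1 h) (mem_image_swap.1 h')⟩, ?_⟩
  rintro w m ⟨ha, hw, hm⟩
  exact hM.2 m w ⟨ha.symm, fun w' h => hm w' (mem_image_swap.2 h),
    fun m' h => hw m' (mem_image_swap.2 h)⟩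

/-- The join for the women is the meet for the men, since domination reverses when seen from the
other side. -/
theorem IsStable.exists_meet (hM : I.IsStable M) (hM' : I.IsStable M') :
    ∃ N, I.IsStable N ∧ I.Dom M N ∧ I.Dom M' N ∧ ∀ p ∈ N, p ∈ M ∨ p ∈ M' := by
  obtain ⟨K, hK, d1, d2, hs⟩ := hM.swap.exists_join hM'.swap
  have hN : I.IsStable (K.image Prod.swap) := hK.swap
  refine ⟨K.image Prod.swap, hN, dom_of_women hM hN ?_, dom_of_women hM' hN ?_, ?_⟩
  · exact fun m m' w h h' => d1 w m' m (mem_image_swap.1 h') (mem_image_swap.2 h)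
  · exact fun m m' w h h' => d2 w m' m (mem_image_swap.1 h') (mem_image_swap.2 h)
  · rintro ⟨m, w⟩ h
    have := hs (w, m) (mem_image_swap.1 h)
    rwa [mem_image_swap, mem_image_swap] at this

/-! ### The Gale-Shapley algorithm -/

theorem mem_proposals {X : Finset (U × W)} : (m, w) ∈ I.proposals X ↔
    w ∈ I.manList m ∧ (m, w) ∉ X ∧
      ∀ x, x ∈ I.manList m → (m, x) ∉ X → I.rankU m w ≤ I.rankU m x := by
  simp [proposals]

theorem mem_round {X : Finset (U × W)} : (m, w) ∈ I.round X ↔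
    (m, w) ∈ X ∨ (m, w) ∈ I.proposals X ∧ (m ∉ I.womanList w ∨
      ∃ x, (x, w) ∈ I.proposals X ∧ x ∈ I.womanList w ∧ I.rankW w x < I.rankW w m) := by
  simp [round]

/-- A man who has not been rejected by everybody on his list makes a proposal. -/
theorem exists_proposal {X : Finset (U × W)} (h : w ∈ I.manList m) (hX : (m, w) ∉ X) :
    ∃ x, (m, x) ∈ I.proposals X ∧ I.rankU m x ≤ I.rankU m w := by
  classical
  obtain ⟨x, hx, hmin⟩ := Finset.exists_min_image
    (Finset.univ.filter fun x => x ∈ I.manList m ∧ (m, x) ∉ X) (I.rankU m)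
    ⟨w, by simp [h, hX]⟩
  simp only [Finset.mem_filter, Finset.mem_univ, true_and] at hx hmin
  exact ⟨x, mem_proposals.2 ⟨hx.1, hx.2, fun y h1 h2 => hmin y ⟨h1, h2⟩⟩, hmin w ⟨h, hX⟩⟩

/-- The rejections after `k` rounds. -/
noncomputable def rejections (I : SMI U W) (k : ℕ) : Finset (U × W) := I.round^[k] ∅

theorem rejections_succ (k : ℕ) : I.rejections (k + 1) = I.round (I.rejections k) :=
  Function.iterate_succ_apply' _ _ _

theorem subset_round (X : Finset (U × W)) : X ⊆ I.round X :=
  fun ⟨_, _⟩ h => mem_round.2 (Or.inl h)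

/-- A woman who has rejected a man on her list has a proposal of a better man. -/
theorem exists_better_proposal (k : ℕ) (h : (m, w) ∈ I.rejections k) (hm : m ∈ I.womanList w) :
    ∃ x, (x, w) ∈ I.proposals (I.rejections k) ∧ x ∈ I.womanList w ∧
      I.rankW w x < I.rankW w m := by
  classical
  induction k generalizing m with
  | zero => simp [rejections] at h
  | succ k ih =>
    rw [rejections_succ] at h ⊢
    set X := I.rejections k with hX
    have h1 : ∃ x, (x, w) ∈ I.proposals X ∧ x ∈ I.womanList w ∧ I.rankW w x < I.rankW w m := by
      rcases mem_round.1 h with h | ⟨-, h | h⟩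
      · exact ih h hm
      · exact absurd hm h
      · exact h
    obtain ⟨x₀, hx₀, hx₀', hlt⟩ := h1
    -- The best acceptable proposer of this round is not rejected, so he proposes to `w` again in
    -- the next one.
    obtain ⟨x, hx, hmin⟩ := Finset.exists_min_image
      (Finset.univ.filter fun x => (x, w) ∈ I.proposals X ∧ x ∈ I.womanList w) (I.rankW w)
      ⟨x₀, by simp [hx₀, hx₀']⟩
    simp only [Finset.mem_filter, Finset.mem_univ, true_and] at hx hmin
    refine ⟨x, ?_, hx.2, (hmin x₀ ⟨hx₀, hx₀'⟩).trans_lt hlt⟩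
    obtain ⟨p1, p2, p3⟩ := mem_proposals.1 hx.1
    refine mem_proposals.2 ⟨p1, fun hr => ?_, fun y hy hy' => p3 y hy fun hc =>
      hy' (subset_round _ hc)⟩
    rcases mem_round.1 hr with h | ⟨-, h | ⟨y, hy, hy', hlt⟩⟩
    · exact p2 h
    · exact h hx.2
    · exact absurd hlt (hmin y ⟨hy, hy'⟩).not_gt

/-- No pair of a stable matching is rejected. -/
theorem IsStable.notMem_rejections (hM : I.IsStable M) (k : ℕ) (h : (m, w) ∈ M) :
    (m, w) ∉ I.rejections k := by
  induction k generalizing m w with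
  | zero => simp [rejections]
  | succ k ih =>
    rw [rejections_succ, mem_round]
    rintro (hr | ⟨-, hr | ⟨x, hx, hx', hlt⟩⟩)
    · exact ih h hr
    · exact hr (hM.1.acceptable _ _ h).2
    · obtain ⟨p1, p2, p3⟩ := mem_proposals.1 hx
      refine hM.2 x w ⟨⟨p1, hx'⟩, fun y hy => ?_, hM.1.womanWould_of_lt h hlt⟩
      refine lt_of_le_of_ne (p3 y (hM.1.acceptable _ _ hy).1 (ih hy)) fun he => ?_
      obtain rfl := rankU_injOn p1 he
      obtain rfl := hM.1.woman_unique _ _ _ hy h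
      exact hlt.ne rfl

/-- Until the process is stationary each round adds a pair. Were it not stationary by now, `card +
1` rounds would give more than `card` rejections. -/
theorem round_rejections_card :
    I.round (I.rejections (Fintype.card (U × W))) = I.rejections (Fintype.card (U × W)) := by
  by_contra hne
  have hstep : ∀ k, I.round (I.rejections k) = I.rejections k →
      ∀ j, I.rejections (k + j) = I.rejections k := by
    intro k hk j
    induction j with
    | zero => rfl
    | succ j ih => rw [← add_assoc, rejections_succ, ih, hk]
  have hall : ∀ k ≤ Fintype.card (U × W), I.rejections k ⊂ I.rejections (k + 1) := by
    intro k hk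
    rw [rejections_succ]
    refine (subset_round _).ssubset_of_ne fun he => hne ?_
    have := hstep k he.symm (Fintype.card (U × W) - k)
    rw [Nat.add_sub_cancel' hk] at this
    rw [this, ← he]
  have hcard : ∀ k ≤ Fintype.card (U × W) + 1, k ≤ (I.rejections k).card := by
    intro k hk
    induction k with
    | zero => exact Nat.zero_le _
    | succ k ih =>
      exact (ih (by omega)).trans_lt (Finset.card_lt_card (hall k (by omega)))
  have := (hcard _ le_rfl).trans (Finset.card_le_univ _)
  omega

theorem mgs_eq : I.mgs = I.proposals (I.rejections (Fintype.card (U × W))) := rfl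

/-- At the fixed point no standing proposal is rejected. For an acceptable pair, either the woman
rejected the man and holds a better proposal, or he was not rejected and proposes to her or to
someone better. -/
theorem isStable_mgs (I : SMI U W) : I.IsStable I.mgs := by
  rw [mgs_eq]
  set X := I.rejections (Fintype.card (U × W)) with hX
  have hfix : ∀ {m w}, (m, w) ∈ I.proposals X → m ∈ I.womanList w ∧
      ∀ x, (x, w) ∈ I.proposals X → x ∈ I.womanList w → I.rankW w m ≤ I.rankW w x := by
    intro m w h
    have : (m, w) ∉ I.round X := by
      rw [hX, round_rejections_card]
      exact (mem_proposals.1 h).2.1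
    rw [mem_round] at this
    push Not at this
    exact this.2 h
  refine ⟨⟨fun m w h => ⟨(mem_proposals.1 h).1, (hfix h).1⟩, ?_, ?_⟩, ?_⟩
  · intro m w w' h h'
    obtain ⟨h1, h2, h3⟩ := mem_proposals.1 h
    obtain ⟨h1', h2', h3'⟩ := mem_proposals.1 h'
    exact rankU_injOn h1 ((h3 _ h1' h2').antisymm (h3' _ h1 h2))
  · intro m m' w h h'
    exact rankW_injOn (hfix h).1
      (((hfix h).2 _ h' (hfix h').1).antisymm ((hfix h').2 _ h (hfix h).1))
  · rintro m w ⟨ha, hm, hw⟩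
    by_cases hr : (m, w) ∈ X
    · obtain ⟨x, hx, -, hlt⟩ := exists_better_proposal _ hr ha.2
      exact absurd (hw _ hx) hlt.not_gt
    · obtain ⟨x, hx, hle⟩ := exists_proposal ha.1 hr
      exact absurd (hm _ hx) hle.not_gt

theorem dom_mgs (hM : I.IsStable M) : I.Dom I.mgs M := by
  intro m w w' h h'
  exact (mem_proposals.1 h).2.2 _ (hM.1.acceptable _ _ h').1 (hM.notMem_rejections _ h')

theorem isStable_wgs (I : SMI U W) : I.IsStable I.wgs :=
  (isStable_mgs I.swap).swap

theorem dom_wgs (hM : I.IsStable M) : I.Dom M I.wgs :=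
  dom_of_women hM I.isStable_wgs fun m m' w h h' =>
    dom_mgs hM.swap w m' m (mem_image_swap.1 h') (mem_image_swap.2 h)

variable {ρ τ : Finset (U × W)}

/-! ### Rotations -/

theorem IsNext.unique (h : I.IsNext M m w) (h' : I.IsNext M m w') : w = w' :=
  rankU_injOn h.1.1.1 ((h.2 _ h'.1).antisymm (h'.2 _ h.1))

theorem IsNext.rankU_lt (hM : I.IsMatching M) (h : I.IsNext M m w') (hw : (m, w) ∈ M) :
    I.rankU m w < I.rankU m w' := by
  obtain ⟨x, hx, hlt⟩ := h.1.2.1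
  rwa [hM.man_unique _ _ _ hw hx]

open Fin.CommRing in
theorem cyclic_induction {q : ℕ} {P : Fin (q + 1) → Prop} (hP : ∀ i, P i → P (i + 1))
    {i : Fin (q + 1)} (hi : P i) (j : Fin (q + 1)) : P j := by
  have h : ∀ n : ℕ, P (i + (n : Fin (q + 1))) := by
    intro n
    induction n with
    | zero => simpa using hi
    | succ n ih =>
      rw [Nat.cast_succ, ← add_assoc]
      exact hP _ ih
  have := h (j - i).val
  rwa [Fin.cast_val_eq_self, add_sub_cancel] at this

/-- A point of a finite type reaches a cycle. -/
theorem exists_cycle {α : Type*} [Finite α] [Nonempty α] (f : α → α) :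
    ∃ (q : ℕ) (p : Fin (q + 1) → α), Function.Injective p ∧ ∀ i, p (i + 1) = f (p i) := by
  obtain ⟨x⟩ := ‹Nonempty α›
  obtain ⟨i, j, hij, he⟩ : ∃ i j : ℕ, i < j ∧ f^[i] x = f^[j] x := by
    obtain ⟨i, j, hne, he⟩ := Finite.exists_ne_map_eq_of_infinite fun n : ℕ => f^[n] x
    rcases hne.lt_or_gt with h | h
    exacts [⟨i, j, h, he⟩, ⟨j, i, h, he.symm⟩]
  set y := f^[i] x with hy
  have hper : Function.IsPeriodicPt f (j - i) y := by
    rw [Function.IsPeriodicPt, Function.IsFixedPt, hy, ← Function.iterate_add_apply,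
      Nat.sub_add_cancel hij.le, ← he]
  have hpos : 0 < Function.minimalPeriod f y :=
    hper.minimalPeriod_pos (by omega)
  obtain ⟨q, hq⟩ := Nat.exists_eq_add_one_of_ne_zero hpos.ne'
  refine ⟨q, fun i => f^[i.val] y, fun a b hab => Fin.ext ?_, fun a => ?_⟩
  · have hlt : ∀ c : Fin (q + 1), c.val < Function.minimalPeriod f y := fun c => by
      rw [hq]; exact c.isLt
    exact Function.iterate_injOn_Iio_minimalPeriod (hlt a) (hlt b) hab
  · show f^[(a + 1).val] y = f (f^[a.val] y)
    rw [← Function.iterate_succ_apply' f, ← Function.iterate_mod_minimalPeriod_eq (n := _ + 1), hq,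
      Fin.val_add, Fin.val_one', Nat.add_mod_mod]

/-- The step from one pair to the next in a rotation, seen from a stable matching `M'` in which the
man of the first pair is worse off. -/
theorem IsNext.manWould (hM : I.IsStable M) (hM' : I.IsStable M') (hw : (m, w) ∈ M)
    (hm : I.ManWould M' m w) (h : I.IsNext M m w') :
    ∃ m', (m', w') ∈ M ∧ I.ManWould M' m' w' := by
  -- The partner `x` of `m` in `M'` is a candidate for `s(m, M)`, so `w'` is `x` or comes before
  -- `x`. In the latter case stability of `M'` gives `w'` a partner in `M'` at least as good as `m`.
  -- Either way `w'` improves in `M'`, and her partner in `M` loses.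
  obtain ⟨x, hx, hx'⟩ := exists_partner_improves hM hM' hw hm
  have hl : I.IsLater M m x := ⟨hM'.1.acceptable _ _ hx, ⟨w, hw, hm _ hx⟩, hx'⟩
  rcases (h.2 _ hl).lt_or_eq with hlt | he
  · have hb := hM'.2 m w'
    have hmw := hM'.1.manWould_of_lt hx hlt
    simp only [Blocks, h.1.1, hmw, true_and, WomanWould, not_forall, not_lt] at hb
    obtain ⟨y, hy, hle⟩ := hb
    exact exists_partner_prefers hM hM' hy fun z hz => hle.trans_lt (h.1.2.2 z hz)
  · obtain rfl := rankU_injOn h.1.1.1 he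
    exact exists_partner_prefers hM hM' hx hx'

/-- The rotations that have to be eliminated on the way to `M`: all their men are worse off
in `M`. -/
def past (I : SMI U W) (M : Finset (U × W)) : Set (Finset (U × W)) :=
  {ρ | ρ ∈ I.rotations ∧ ∀ p ∈ ρ, I.ManWould M p.1 p.2}

theorem Exposed.subset (h : I.Exposed M ρ) : ρ ⊆ M := by
  obtain ⟨-, q, p, hp, rfl⟩ := h
  intro x hx
  obtain ⟨i, -, rfl⟩ := Finset.mem_image.1 hx
  exact (hp.2 i).1

theorem nonempty_of_mem_rotations (h : ρ ∈ I.rotations) : ρ.Nonempty := by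
  obtain ⟨M, -, q, p, hp, rfl⟩ := h
  exact ⟨p 0, Finset.mem_image_of_mem _ (Finset.mem_univ _)⟩

theorem Exposed.mem_rotations (h : I.Exposed M ρ) : ρ ∈ I.rotations := ⟨M, h⟩

theorem Eliminates.exposed (h : I.Eliminates M ρ N) : I.Exposed M ρ := by
  obtain ⟨hM, q, p, hp, he, -⟩ := h
  exact ⟨hM, q, p, hp, he⟩

theorem Exposed.exists_eliminates (h : I.Exposed M ρ) : ∃ N, I.Eliminates M ρ N := by
  obtain ⟨hM, q, p, hp, he⟩ := h
  exact ⟨_, hM, q, p, hp, he, rfl⟩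

theorem notMem_past_of_mem (hp : (m, w) ∈ M) (hρ : (m, w) ∈ ρ) : ρ ∉ I.past M := fun h =>
  (h.2 _ hρ _ hp).ne rfl

theorem Exposed.notMem_past (h : I.Exposed M ρ) : ρ ∉ I.past M := by
  obtain ⟨⟨m, w⟩, hp⟩ := nonempty_of_mem_rotations h.mem_rotations
  exact notMem_past_of_mem (h.subset hp) hp

/-- If one man of a rotation is worse off in `M`, then all of them are. -/
theorem mem_past_of_manWould (hM : I.IsStable M) (hρ : ρ ∈ I.rotations) (hp : (m, w) ∈ ρ)
    (hm : I.ManWould M m w) : ρ ∈ I.past M := by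
  refine ⟨hρ, ?_⟩
  obtain ⟨K, hK, q, p, hrot, rfl⟩ := hρ
  obtain ⟨i, -, hi⟩ := Finset.mem_image.1 hp
  have key : ∀ j, I.ManWould M (p j).1 (p j).2 := by
    refine cyclic_induction (fun j hj => ?_) (i := i) (by rw [hi]; exact hm)
    obtain ⟨x, hx, hx'⟩ := (hrot.2 j).2.manWould hK hM (hrot.2 j).1 hj
    rwa [hK.1.woman_unique _ _ _ hx (hrot.2 (j + 1)).1] at hx'
  intro x hx
  obtain ⟨j, -, rfl⟩ := Finset.mem_image.1 hx
  exact key j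

/-- If some man is worse off in `M'`, then a rotation that leads towards `M'` is exposed on `M`. -/
theorem exists_exposed (hM : I.IsStable M) (hM' : I.IsStable M') (hw : (m, w) ∈ M)
    (hm : I.ManWould M' m w) : ∃ ρ, I.Exposed M ρ ∧ ρ ∈ I.past M' := by
  classical
  -- By `IsNext.manWould`, passing to the pair of `s(m, M)` maps this finite nonempty set of losing
  -- men's pairs to itself; a cycle of the map is the rotation.
  let A := {p : U × W // p ∈ M ∧ I.ManWould M' p.1 p.2}
  have hstep : ∀ p : A, ∃ p' : A, I.IsNext M p.1.1 p'.1.2 := by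
    rintro ⟨⟨a, b⟩, hb, ha⟩
    obtain ⟨x, hx, hx'⟩ := exists_partner_improves hM hM' hb ha
    obtain ⟨y, hy, hmin⟩ := Finset.exists_min_image
      (Finset.univ.filter fun y => I.IsLater M a y) (I.rankU a)
      ⟨x, by simpa using ⟨hM'.1.acceptable _ _ hx, ⟨b, hb, ha _ hx⟩, hx'⟩⟩
    simp only [Finset.mem_filter, Finset.mem_univ, true_and] at hy hmin
    obtain ⟨c, hc, hc'⟩ := IsNext.manWould hM hM' hb ha ⟨hy, hmin⟩
    exact ⟨⟨(c, y), hc, hc'⟩, hy, hmin⟩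
  choose f hf using hstep
  have : Nonempty A := ⟨⟨(m, w), hw, hm⟩⟩
  obtain ⟨q, p, hinj, hp⟩ := exists_cycle f
  have hex : I.Exposed M (Finset.univ.image fun i => (p i).1) :=
    ⟨hM, q, fun i => (p i).1, ⟨Subtype.val_injective.comp hinj, fun i => ⟨(p i).2.1, by
      show I.IsNext M (p i).1.1 (p (i + 1)).1.2
      rw [hp]; exact hf _⟩⟩, rfl⟩
  refine ⟨_, hex, hex.mem_rotations, fun x hx => ?_⟩
  obtain ⟨i, -, rfl⟩ := Finset.mem_image.1 hx
  exact (p i).2.2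

/-! ### The effect of eliminating one rotation. -/

theorem Eliminates.cases (h : I.Eliminates M ρ N) (hw : (m, w) ∈ N) :
    (m, w) ∈ M ∧ (m, w) ∉ ρ ∨ ∃ x, (m, x) ∈ ρ ∧ I.IsNext M m w := by
  obtain ⟨hM, q, p, hp, rfl, rfl⟩ := h
  rcases Finset.mem_union.1 hw with hw | hw
  · exact Or.inl (Finset.mem_sdiff.1 hw)
  · obtain ⟨i, -, hi⟩ := Finset.mem_image.1 hw
    simp only [Prod.mk.injEq] at hi
    obtain ⟨rfl, rfl⟩ := hi
    exact Or.inr ⟨_, Finset.mem_image_of_mem _ (Finset.mem_univ i), (hp.2 i).2⟩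

theorem Eliminates.mem_of_notMem (h : I.Eliminates M ρ N) (hw : (m, w) ∈ M) (hρ : (m, w) ∉ ρ) :
    (m, w) ∈ N := by
  obtain ⟨hM, q, p, hp, rfl, rfl⟩ := h
  exact Finset.mem_union_left _ (Finset.mem_sdiff.2 ⟨hw, hρ⟩)

theorem Eliminates.dom (h : I.Eliminates M ρ N) : I.Dom M N := by
  intro m w w' hw hw'
  rcases h.cases hw' with ⟨h', -⟩ | ⟨x, -, h'⟩
  · rw [h.1.1.man_unique _ _ _ hw h']
  · exact (h'.rankU_lt h.1.1 hw).le

theorem Eliminates.exists_woman (h : I.Eliminates M ρ N) (hw : (m, w) ∈ M) :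
    ∃ m', (m', w) ∈ N ∧ I.rankW w m' ≤ I.rankW w m ∧ ((m, w) ∈ ρ → I.rankW w m' < I.rankW w m) := by
  by_cases hρ : (m, w) ∈ ρ
  · obtain ⟨hM, q, p, hp, rfl, rfl⟩ := h
    obtain ⟨j, -, hj⟩ := Finset.mem_image.1 hρ
    -- The woman of pair `j` receives the man of the cyclically preceding pair, who is better for
    -- her by the definition of `s`.
    have hn := (hp.2 (j - 1)).2
    rw [sub_add_cancel, hj] at hn
    have hlt := hn.1.2.2 _ hw
    refine ⟨(p (j - 1)).1, Finset.mem_union_right _ (Finset.mem_image.2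
      ⟨j - 1, Finset.mem_univ _, ?_⟩), hlt.le, fun _ => hlt⟩
    rw [sub_add_cancel, hj]
  · exact ⟨m, h.mem_of_notMem hw hρ, le_rfl, fun h => absurd h hρ⟩

theorem Eliminates.isMatching (h : I.Eliminates M ρ N) : I.IsMatching N := by
  refine ⟨fun m w hw => ?_, fun m w w' hw hw' => ?_, ?_⟩
  · rcases h.cases hw with ⟨h', -⟩ | ⟨x, -, h'⟩
    · exact h.1.1.acceptable _ _ h'
    · exact h'.1.1
  · rcases h.cases hw with ⟨h1, h2⟩ | ⟨x, h1, h2⟩ <;>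
      rcases h.cases hw' with ⟨h3, h4⟩ | ⟨y, h3, h4⟩
    · exact h.1.1.man_unique _ _ _ h1 h3
    · rw [h.1.1.man_unique _ _ _ h1 (h.exposed.subset h3)] at h2
      exact absurd h3 h2
    · rw [h.1.1.man_unique _ _ _ h3 (h.exposed.subset h1)] at h4
      exact absurd h1 h4
    · exact h2.unique h4
  · obtain ⟨hM, q, p, hp, rfl, rfl⟩ := h
    intro m m' w hw hw'
    have key : ∀ i a, (a, (p (i + 1)).2) ∈ M → (a, (p (i + 1)).2) ∈ Finset.univ.image p := by
      intro i a ha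
      rw [hM.1.woman_unique _ _ _ ha (hp.2 (i + 1)).1]
      exact Finset.mem_image_of_mem _ (Finset.mem_univ _)
    rcases Finset.mem_union.1 hw with hw | hw <;> rcases Finset.mem_union.1 hw' with hw' | hw'
    · exact hM.1.woman_unique _ _ _ (Finset.mem_sdiff.1 hw).1 (Finset.mem_sdiff.1 hw').1
    · obtain ⟨i, -, hi⟩ := Finset.mem_image.1 hw'
      simp only [Prod.mk.injEq] at hi
      obtain ⟨rfl, rfl⟩ := hi
      exact absurd (key i _ (Finset.mem_sdiff.1 hw).1) (Finset.mem_sdiff.1 hw).2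
    · obtain ⟨i, -, hi⟩ := Finset.mem_image.1 hw
      simp only [Prod.mk.injEq] at hi
      obtain ⟨rfl, rfl⟩ := hi
      exact absurd (key i _ (Finset.mem_sdiff.1 hw').1) (Finset.mem_sdiff.1 hw').2
    · obtain ⟨i, -, hi⟩ := Finset.mem_image.1 hw
      obtain ⟨j, -, hj⟩ := Finset.mem_image.1 hw'
      simp only [Prod.mk.injEq] at hi hj
      obtain ⟨rfl, rfl⟩ := hi
      obtain ⟨rfl, hj⟩ := hj
      have h1 := (hp.2 (i + 1)).1
      have h2 := (hp.2 (j + 1)).1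
      have : p (j + 1) = p (i + 1) :=
        Prod.ext (hM.1.woman_unique _ _ _ (by rw [← hj]; exact h2) h1) hj
      rw [add_right_cancel (hp.1 this)]

/-- Eliminating a rotation gives a stable matching. -/
theorem Eliminates.isStable (h : I.Eliminates M ρ N) : I.IsStable N := by
  refine ⟨h.isMatching, ?_⟩
  rintro m w ⟨ha, hm, hw⟩
  -- No woman loses by the elimination, so `w` would also have accepted `m` in `M`. Stability of `M`
  -- then puts `w` after the partner of `m`, and a man who moves goes to the first such woman, hence
  -- not past `w`.
  have hwM : I.WomanWould M w m := fun x hx => by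
    obtain ⟨y, hy, hle, -⟩ := h.exists_woman hx
    exact (hw y hy).trans_le hle
  have hb := h.1.2 m w
  simp only [Blocks, ha, hwM, true_and, and_true, ManWould, not_forall, not_lt] at hb
  obtain ⟨x, hx, hle⟩ := hb
  rcases hle.lt_or_eq with hlt | he
  · have hl : I.IsLater M m w := ⟨ha, ⟨x, hx, hlt⟩, hwM⟩
    by_cases hρ : (m, x) ∈ ρ
    · obtain ⟨hM, q, p, hp, rfl, rfl⟩ := h
      obtain ⟨i, -, hi⟩ := Finset.mem_image.1 hρ
      have hn := (hp.2 i).2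
      rw [hi] at hn
      refine absurd (hm (p (i + 1)).2 (Finset.mem_union_right _ (Finset.mem_image.2
        ⟨i, Finset.mem_univ _, by rw [hi]⟩))) (hn.2 _ hl).not_gt
    · exact absurd (hm _ (h.mem_of_notMem hx hρ)) hlt.not_gt
  · obtain rfl := rankU_injOn (h.1.1.acceptable _ _ hx).1 he
    exact (hwM _ hx).ne rfl

/-- A rotation that becomes past by the elimination of `ρ` is contained in `ρ`. -/
theorem Eliminates.subset_of_mem_past (h : I.Eliminates M ρ N) (hN : τ ∈ I.past N)
    (hM : τ ∉ I.past M) : τ ⊆ ρ := by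
  rintro ⟨m, x⟩ hx
  obtain ⟨K, hK⟩ := hN.1
  have hxK := hK.subset hx
  obtain ⟨w, hw⟩ := hK.1.man_assigned h.1 hxK
  have hle : I.rankU m w ≤ I.rankU m x := by
    by_contra! hlt
    exact hM (mem_past_of_manWould h.1 hN.1 hx (h.1.1.manWould_of_lt hw hlt))
  have hmN := hN.2 _ hx
  by_cases hwρ : (m, w) ∈ ρ
  · rcases hle.lt_or_eq with hlt | he
    -- Here `w` is strictly before `x`. By opposition `x` prefers `m` to her state in `M`, so `m`
    -- moves to `x` or to an earlier woman, and cannot be worse off than with `x` in `N`.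
    · obtain ⟨y, hy, hy'⟩ := exists_partner_improves h.1 hK.1 hw (hK.1.1.manWould_of_lt hxK hlt)
      obtain rfl := hK.1.1.man_unique _ _ _ hy hxK
      have hl : I.IsLater M m y := ⟨hK.1.1.acceptable _ _ hy, ⟨w, hw, hlt⟩, hy'⟩
      obtain ⟨z, hz⟩ := h.1.man_assigned h.isStable hw
      have hlt' := hmN z hz
      rcases h.cases hz with ⟨h1, h2⟩ | ⟨u, h1, h2⟩
      · rw [h.1.1.man_unique _ _ _ h1 hw] at h2
        exact absurd hwρ h2
      · exact absurd hlt' (h2.2 _ hl).not_gt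
    · rwa [← rankU_injOn (h.1.1.acceptable _ _ hw).1 he]
  · exact absurd (hmN _ (h.mem_of_notMem hw hwρ)) hle.not_gt

theorem Eliminates.mem_past (h : I.Eliminates M ρ N) : ρ ∈ I.past N := by
  refine ⟨h.exposed.mem_rotations, ?_⟩
  rintro ⟨m, w⟩ hw x hx
  have hwM := h.exposed.subset hw
  rcases h.cases hx with ⟨h1, h2⟩ | ⟨u, h1, h2⟩
  · rw [h.1.1.man_unique _ _ _ h1 hwM] at h2
    exact absurd hw h2
  · exact h2.rankU_lt h.1.1 hwM

/-- A pair lies in at most one rotation. -/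
theorem rotation_unique (hρ : ρ ∈ I.rotations) (hτ : τ ∈ I.rotations) (h : (m, w) ∈ ρ)
    (h' : (m, w) ∈ τ) : ρ = τ := by
  have key : ∀ {ρ τ : Finset (U × W)}, ρ ∈ I.rotations → τ ∈ I.rotations → (m, w) ∈ ρ →
      (m, w) ∈ τ → τ ⊆ ρ := by
    rintro ρ τ ⟨M, hM⟩ hτ h h'
    -- Eliminating `ρ` makes the man of the common pair worse off, hence `τ` becomes past; it was
    -- not past before, as that pair was in `M`.
    obtain ⟨N, hN⟩ := hM.exists_eliminates
    exact hN.subset_of_mem_past (mem_past_of_manWould hN.isStable hτ h' (hN.mem_past.2 _ h))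
      (notMem_past_of_mem (hM.subset h) h')
  exact (key hτ hρ h' h).antisymm (key hρ hτ h h')

theorem Dom.past_subset (hM : I.IsStable M) (hN : I.IsStable N) (h : I.Dom M N) :
    I.past M ⊆ I.past N := fun _ hρ => ⟨hρ.1, fun p hp w hw => by
  obtain ⟨x, hx⟩ := hN.man_assigned hM hw
  exact (hρ.2 p hp x hx).trans_le (h _ _ _ hx hw)⟩

theorem Eliminates.past_eq (h : I.Eliminates M ρ N) : I.past N = insert ρ (I.past M) := by
  refine Set.Subset.antisymm (fun τ hτ => ?_) (Set.insert_subset h.mem_past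
    (h.dom.past_subset h.1 h.isStable))
  by_cases hM : τ ∈ I.past M
  · exact Or.inr hM
  · obtain ⟨⟨m, w⟩, hp⟩ := nonempty_of_mem_rotations hτ.1
    exact Or.inl (rotation_unique hτ.1 h.exposed.mem_rotations hp (h.subset_of_mem_past hτ hM hp))

/-- If some man did better in `N`, a rotation of `past M` would be exposed on `N`, but an exposed
rotation is never past. -/
theorem dom_of_past_subset (hM : I.IsStable M) (hN : I.IsStable N) (h : I.past M ⊆ I.past N) :
    I.Dom M N := by
  intro m w w' hw hw'
  by_contra! hlt
  obtain ⟨ρ, h1, h2⟩ := exists_exposed hN hM hw' (hM.1.manWould_of_lt hw hlt)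
  exact h1.notMem_past (h h2)

theorem eq_of_past_eq (hM : I.IsStable M) (hN : I.IsStable N) (h : I.past M = I.past N) : M = N :=
  (dom_of_past_subset hM hN h.subset).antisymm hM hN (dom_of_past_subset hN hM h.symm.subset)

theorem past_mgs (I : SMI U W) : I.past I.mgs = ∅ := by
  refine Set.eq_empty_of_forall_notMem fun ρ hρ => ?_
  obtain ⟨M, hM⟩ := hρ.1
  obtain ⟨⟨m, w⟩, hp⟩ := nonempty_of_mem_rotations hρ.1
  obtain ⟨x, hx⟩ := hM.1.man_assigned I.isStable_mgs (hM.subset hp)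
  exact absurd (hρ.2 _ hp x hx) (dom_mgs hM.1 _ _ _ hx (hM.subset hp)).not_gt

/-! ### Sequences of eliminations -/

variable {l : List (Finset (U × W))}

theorem EliminatesList.isStable (h : I.EliminatesList M l N) (hM : I.IsStable M) :
    I.IsStable N := by
  induction h with
  | nil => exact hM
  | cons h _ ih => exact ih h.isStable

theorem EliminatesList.past_eq (h : I.EliminatesList M l N) :
    I.past N = I.past M ∪ {ρ | ρ ∈ l} := by
  induction h with
  | nil => simp
  | cons h _ ih =>
    rw [ih, h.past_eq]
    ext τ
    simp only [Set.mem_union, Set.mem_insert_iff, Set.mem_ofPred_eq, List.mem_cons]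
    tauto

/-- Every stable matching that `M` dominates is reached from `M`. -/
theorem exists_eliminatesList (hM : I.IsStable M) (hN : I.IsStable N)
    (h : I.past M ⊆ I.past N) :
    ∃ l : List (Finset (U × W)), l.Nodup ∧ (∀ ρ, ρ ∈ l ↔ ρ ∈ I.past N \ I.past M) ∧
      I.EliminatesList M l N := by
  induction hk : (I.past N \ I.past M).ncard generalizing M with
  | zero =>
    rw [Set.ncard_eq_zero, Set.sdiff_eq_empty] at hk
    obtain rfl := eq_of_past_eq hM hN (h.antisymm hk)
    exact ⟨[], List.nodup_nil, by simp, .nil _⟩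
  | succ k ih =>
    have hne : ¬ I.past N ⊆ I.past M := fun hs => by
      rw [Set.sdiff_eq_empty.2 hs] at hk
      simp at hk
    have hnd : ¬ I.Dom N M := fun hd => hne (hd.past_subset hN hM)
    unfold Dom at hnd
    push Not at hnd
    obtain ⟨m, w, w', hw, hw', hlt⟩ := hnd
    obtain ⟨ρ, h1, h2⟩ := exists_exposed hM hN hw' (hN.1.manWould_of_lt hw hlt)
    obtain ⟨K, hK⟩ := h1.exists_eliminates
    have hd : I.past N \ I.past K = (I.past N \ I.past M) \ {ρ} := by
      rw [hK.past_eq, ← Set.union_singleton, Set.sdiff_sdiff]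
    obtain ⟨l, n1, n2, n3⟩ := ih hK.isStable
      (by rw [hK.past_eq]; exact Set.insert_subset h2 h)
      (by rw [hd, Set.ncard_sdiff_singleton_of_mem
        (show ρ ∈ I.past N \ I.past M from ⟨h2, h1.notMem_past⟩), hk]; rfl)
    refine ⟨ρ :: l, List.nodup_cons.2 ⟨fun hl => ?_, n1⟩, fun τ => ?_, .cons hK n3⟩
    · exact ((n2 ρ).1 hl).2 hK.mem_past
    · rw [List.mem_cons, n2, hd]
      constructor
      · rintro (rfl | h)
        exacts [⟨h2, h1.notMem_past⟩, h.1]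
      · intro h
        by_cases he : τ = ρ
        exacts [Or.inl he, Or.inr ⟨h, he⟩]

theorem EliminatesList.exists_mem (h : I.EliminatesList M l N) (hM : (m, w) ∈ M)
    (hN : (m, w) ∉ N) : ∃ ρ ∈ l, (m, w) ∈ ρ := by
  induction h with
  | nil => exact absurd hM hN
  | @cons M ρ _ _ _ h _ ih =>
    by_cases hρ : (m, w) ∈ ρ
    · exact ⟨ρ, by simp, hρ⟩
    · obtain ⟨τ, h1, h2⟩ := ih (h.mem_of_notMem hM hρ) hN
      exact ⟨τ, List.mem_cons_of_mem _ h1, h2⟩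

/-- A pair that is lost on the way from `M` down to `N` lies in a rotation eliminated on the way. -/
theorem exists_mem_past (hM : I.IsStable M) (hN : I.IsStable N) (h : I.Dom M N)
    (hw : (m, w) ∈ M) (hw' : (m, w) ∉ N) : ∃ ρ ∈ I.past N, (m, w) ∈ ρ := by
  obtain ⟨l, -, h2, h3⟩ := exists_eliminatesList hM hN (h.past_subset hM hN)
  obtain ⟨ρ, h4, h5⟩ := h3.exists_mem hw hw'
  exact ⟨ρ, ((h2 ρ).1 h4).1, h5⟩

theorem EliminatesList.exists_exposed (h : I.EliminatesList M l N) (hρ : ρ ∈ l) :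
    ∃ l₁ K, I.EliminatesList M l₁ K ∧ I.Exposed K ρ ∧ l₁ ⊆ l := by
  induction h with
  | nil => simp at hρ
  | @cons M τ _ _ l h _ ih =>
    rcases List.mem_cons.1 hρ with rfl | hρ
    · exact ⟨[], _, .nil _, h.exposed, List.nil_subset _⟩
    · obtain ⟨l₁, K, h1, h2, h3⟩ := ih hρ
      exact ⟨τ :: l₁, K, .cons h h1, h2, List.cons_subset_cons _ h3⟩

/-! ### Closed sets of rotations -/

variable {S : Set (Finset (U × W))}

/-- The rotations eliminated on the way to a stable matching form a closed set. -/
theorem mem_past_of_precedes (hM : I.IsStable M) (hτ : τ ∈ I.past M) (h : I.Precedes ρ τ) :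
    ρ ∈ I.past M := by
  obtain ⟨l, -, h2, h3⟩ := exists_eliminatesList I.isStable_mgs hM (by simp [past_mgs])
  rw [past_mgs, Set.sdiff_empty] at h2
  obtain ⟨l₁, K, h4, h5, h6⟩ := h3.exists_exposed ((h2 τ).2 hτ)
  exact (h2 ρ).1 (h6 (h.2.2 l₁ K h4 h5))

theorem rotClosure_subset_past (hM : I.IsStable M) (h : S ⊆ I.past M) :
    I.rotClosure S ⊆ I.past M := by
  rintro ρ (hρ | ⟨τ, hτ, hρ⟩)
  exacts [h hρ, mem_past_of_precedes hM (h hτ) hρ]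

theorem subset_rotClosure : S ⊆ I.rotClosure S := fun _ h => Or.inl h

/-- The matching is the join: all its pairs come from `M` or `M'`, so a man worse off in both is
worse off in it. -/
theorem exists_past_eq_inter (hM : I.IsStable M) (hM' : I.IsStable M') :
    ∃ N, I.IsStable N ∧ I.past N = I.past M ∩ I.past M' := by
  obtain ⟨N, hN, d1, d2, hs⟩ := hM.exists_join hM'
  refine ⟨N, hN, Set.Subset.antisymm (Set.subset_inter (d1.past_subset hN hM)
    (d2.past_subset hN hM')) ?_⟩
  rintro ρ ⟨h1, h2⟩
  exact ⟨h1.1, fun p hp w hw => (hs _ hw).elim (h1.2 p hp w) (h2.2 p hp w)⟩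

/-- The matching is the meet. One man of a past rotation is worse off already in `M` or in `M'`, and
one man suffices by `mem_past_of_manWould`. -/
theorem exists_past_eq_union (hM : I.IsStable M) (hM' : I.IsStable M') :
    ∃ N, I.IsStable N ∧ I.past N = I.past M ∪ I.past M' := by
  obtain ⟨N, hN, d1, d2, hs⟩ := hM.exists_meet hM'
  refine ⟨N, hN, Set.Subset.antisymm ?_ (Set.union_subset (d1.past_subset hM hN)
    (d2.past_subset hM' hN))⟩
  intro ρ hρ
  obtain ⟨K, hK⟩ := hρ.1
  obtain ⟨⟨m, w⟩, hp⟩ := nonempty_of_mem_rotations hρ.1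
  obtain ⟨x, hx⟩ := hK.1.man_assigned hN (hK.subset hp)
  have hlt := hρ.2 _ hp x hx
  rcases hs _ hx with h | h
  · exact Or.inl (mem_past_of_manWould hM hρ.1 hp (hM.1.manWould_of_lt h hlt))
  · exact Or.inr (mem_past_of_manWould hM' hρ.1 hp (hM'.1.manWould_of_lt h hlt))

theorem exists_past_eq_rotClosure_singleton (hτ : τ ∈ I.rotations) :
    ∃ N, I.IsStable N ∧ I.past N = I.rotClosure {τ} := by
  obtain ⟨M₀, hM₀⟩ := id hτ
  obtain ⟨N₀, hN₀⟩ := hM₀.exists_eliminates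
  obtain ⟨N, ⟨hN, hτN⟩, hmin⟩ := Set.exists_min_image {N | I.IsStable N ∧ τ ∈ I.past N}
    (fun N => (I.past N).ncard) (Set.toFinite _) ⟨N₀, hN₀.isStable, hN₀.mem_past⟩
  -- Fewest past rotations means least, because past sets are closed under intersection.
  have hleast : ∀ K, I.IsStable K → τ ∈ I.past K → I.past N ⊆ I.past K := by
    intro K hK hτK
    obtain ⟨L, hL, he⟩ := exists_past_eq_inter hN hK
    have hle := hmin L ⟨hL, by rw [he]; exact ⟨hτN, hτK⟩⟩
    rw [he] at hle
    exact Set.inter_eq_left.1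
      (Set.eq_of_subset_of_ncard_le Set.inter_subset_left hle (Set.toFinite _))
  refine ⟨N, hN, Set.Subset.antisymm (fun ρ hρ => ?_)
    (rotClosure_subset_past hN (Set.singleton_subset_iff.2 hτN))⟩
  by_cases he : ρ = τ
  · exact Or.inl he
  -- Eliminating `τ` from any `M` that exposes it gives a past set containing `τ`, hence `ρ`; so `ρ`
  -- was eliminated on the way to `M`.
  · refine Or.inr ⟨τ, rfl, hρ.1, hτ, fun l M hl hM => ?_⟩
    obtain ⟨K, hK⟩ := hM.exists_eliminates
    have := hleast K hK.isStable hK.mem_past hρ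
    rw [hK.past_eq, hl.past_eq, past_mgs] at this
    simpa [he] using this

theorem exists_past_eq_union_rotClosure (hM : I.IsStable M) (hS : S ⊆ I.rotations) :
    ∃ N, I.IsStable N ∧ I.past N = I.past M ∪ I.rotClosure S := by
  induction S, Set.toFinite S using Set.Finite.induction_on with
  | empty => exact ⟨M, hM, by simp [rotClosure]⟩
  | @insert τ S _ _ ih =>
    obtain ⟨hτ, hS⟩ := Set.insert_subset_iff.1 hS
    obtain ⟨N, hN, he⟩ := ih hS
    obtain ⟨K, hK, he'⟩ := exists_past_eq_rotClosure_singleton hτ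
    obtain ⟨L, hL, he''⟩ := exists_past_eq_union hN hK
    refine ⟨L, hL, ?_⟩
    rw [he'', he, he']
    ext ρ
    simp only [rotClosure, Set.mem_union, Set.mem_ofPred_eq, Set.mem_singleton_iff,
      Set.mem_insert_iff, exists_eq_left, exists_eq_or_imp]
    generalize (∃ σ ∈ S, I.Precedes ρ σ) = X
    tauto

/-- Supplies the matching `M/Q'` in both loops, where `Q` is `past M`. -/
theorem exists_eliminatesSet (hM : I.IsStable M) (hS : S ⊆ I.rotations) :
    ∃ N, I.EliminatesSet M (I.rotClosure S \ I.past M) N := by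
  obtain ⟨N, hN, he⟩ := exists_past_eq_union_rotClosure hM hS
  obtain ⟨l, h1, h2, h3⟩ := exists_eliminatesList hM hN (by rw [he]; exact Set.subset_union_left)
  exact ⟨N, l, h1, by rwa [he, Set.union_sdiff_left] at h2, h3⟩

theorem EliminatesSet.isStable (h : I.EliminatesSet M S N) (hM : I.IsStable M) : I.IsStable N := by
  obtain ⟨l, -, -, h⟩ := h
  exact h.isStable hM

theorem EliminatesSet.past_eq (h : I.EliminatesSet M S N) : I.past N = I.past M ∪ S := by
  obtain ⟨l, -, h2, h⟩ := h
  rw [h.past_eq]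
  congr 1
  ext ρ
  exact h2 ρ

theorem exists_isPhi (hM : I.IsStable M) (hw : (m, w) ∈ M) (hw' : (m, w) ∉ I.wgs) :
    ∃ ρ, I.IsPhi m w ρ := by
  obtain ⟨ρ, h1, h2⟩ := exists_mem_past hM I.isStable_wgs (dom_wgs hM) hw hw'
  exact ⟨ρ, h1.1, h2, fun τ hτ h => rotation_unique hτ h1.1 h h2⟩

/-! ### Degrees and regret -/

theorem le_dU (h : (m, w) ∈ M) : I.rankU m w ≤ I.dU M :=
  Finset.le_sup (f := fun p : U × W => I.rankU p.1 p.2) h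

theorem le_dW (h : (m, w) ∈ M) : I.rankW w m ≤ I.dW M :=
  Finset.le_sup (f := fun p : U × W => I.rankW p.2 p.1) h

theorem Dom.dU_le (hM : I.IsStable M) (hN : I.IsStable N) (h : I.Dom M N) : I.dU M ≤ I.dU N := by
  refine Finset.sup_le fun ⟨m, w⟩ hw => ?_
  obtain ⟨x, hx⟩ := hM.man_assigned hN hw
  exact (h _ _ _ hw hx).trans (le_dU hx)

theorem Dom.dW_le (hM : I.IsStable M) (hN : I.IsStable N) (h : I.Dom M N) : I.dW N ≤ I.dW M := by
  refine Finset.sup_le fun ⟨m, w⟩ hw => ?_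
  obtain ⟨x, hx⟩ := hN.woman_assigned hM hw
  exact (h.women hM hN hx hw).trans (le_dW hx)

/-- Below a matching whose man-degree has reached the woman-degree, the regret does not decrease. -/
theorem Dom.regret_le (hM : I.IsStable M) (hN : I.IsStable N) (h : I.Dom M N)
    (hd : I.dW M ≤ I.dU M) : I.regret M ≤ I.regret N := by
  have h1 := h.dU_le hM hN
  have h2 := h.dW_le hM hN
  unfold regret
  rw [abs_of_nonneg (by omega)]
  exact le_trans (by omega) (le_abs_self _)

theorem Dom.manWould (hN : I.IsStable N) (h : I.Dom M N) (hw : (m, w) ∈ M) (hw' : (m, w) ∉ N) :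
    I.ManWould N m w := fun _ hx =>
  lt_of_le_of_ne (h _ _ _ hw hx) fun he => hw' (hN.1.mem_of_rankU_eq hx he.symm)

theorem EliminatesSet.dom (h : I.EliminatesSet M S N) (hM : I.IsStable M) : I.Dom M N :=
  dom_of_past_subset hM (h.isStable hM) (by rw [h.past_eq]; exact Set.subset_union_left)

theorem regret_better_le_left (M M' : Finset (U × W)) :
    I.regret (I.better M M') ≤ I.regret M := by
  unfold better
  split_ifs with h
  exacts [le_rfl, not_lt.1 h]

theorem regret_better_le_right (M M' : Finset (U × W)) :
    I.regret (I.better M M') ≤ I.regret M' := by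
  unfold better
  split_ifs with h
  exacts [h.le, le_rfl]

theorem IsStable.better (hM : I.IsStable M) (hM' : I.IsStable M') :
    I.IsStable (I.better M M') := by
  unfold SMI.better
  split_ifs
  exacts [hM, hM']

/-! ### The matchings that the algorithm is bound to find -/

/-- `K` is a regret-equal stable matching with the fewest eliminated rotations, and `N` is a stable
matching with the same man-degree that dominates `K` and is not dominated by another one. -/
structure IsTarget (I : SMI U W) (K N : Finset (U × W)) : Prop where
  isStable : I.IsStable K
  regret_le : ∀ M, I.IsStable M → I.regret K ≤ I.regret M
  regret_lt : ∀ M, I.IsStable M → I.Dom M K → M ≠ K → I.regret K < I.regret M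
  isStable' : I.IsStable N
  dom : I.Dom N K
  dU_eq : I.dU N = I.dU K
  dU_lt : ∀ M, I.IsStable M → I.Dom M N → M ≠ N → I.dU M < I.dU N

theorem Dom.eq_of_ncard_le (hM : I.IsStable M) (hN : I.IsStable N) (h : I.Dom M N)
    (hc : (I.past N).ncard ≤ (I.past M).ncard) : M = N :=
  eq_of_past_eq hM hN
    (Set.eq_of_subset_of_ncard_le (h.past_subset hM hN) hc (Set.toFinite _))

/-- Strict domination strictly enlarges the past set, so minimising its size twice gives the strict
inequalities `regret_lt` and `dU_lt`. -/
theorem exists_isTarget (I : SMI U W) : ∃ K N, I.IsTarget K N := by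
  obtain ⟨K₀, hK₀, hmin₀⟩ := Set.exists_min_image {M | I.IsStable M} I.regret (Set.toFinite _)
    ⟨_, I.isStable_mgs⟩
  obtain ⟨K, ⟨hK, hKr⟩, hmin⟩ := Set.exists_min_image
    {M | I.IsStable M ∧ I.regret M ≤ I.regret K₀} (fun M => (I.past M).ncard) (Set.toFinite _)
    ⟨K₀, hK₀, le_rfl⟩
  obtain ⟨N, ⟨hN, hd, he⟩, hmin'⟩ := Set.exists_min_image
    {M | I.IsStable M ∧ I.Dom M K ∧ I.dU M = I.dU K} (fun M => (I.past M).ncard) (Set.toFinite _)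
    ⟨K, hK, fun _ _ _ h h' => (congrArg _ (hK.1.man_unique _ _ _ h h')).le, rfl⟩
  refine ⟨K, N, hK, fun M hM => hKr.trans (hmin₀ M hM), fun M hM hMK hne => ?_, hN, hd, he,
    fun M hM hMN hne => ?_⟩
  · by_contra! hle
    exact hne (hMK.eq_of_ncard_le hM hK (hmin M ⟨hM, hle.trans hKr⟩))
  · refine lt_of_le_of_ne (hMN.dU_le hM hN) fun h => hne ?_
    exact hMN.eq_of_ncard_le hM hN (hmin' M ⟨hM, hMN.trans hN hM hd, h.trans he⟩)

variable {K : Finset (U × W)}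

theorem IsTarget.dU_lt_dW (hT : I.IsTarget K N) (hM : I.IsStable M) (h : I.Dom M K) (hne : M ≠ K) :
    I.dU M < I.dW M := by
  by_contra! hle
  exact absurd (hT.regret_lt M hM h hne) (h.regret_le hM hT.isStable hle).not_gt

/-- The column operation, started above `K` in the column of `K`, stays above `K` and does not
reject. -/
theorem IsTarget.col_step (hT : I.IsTarget K N) (hM : I.IsStable M) (h : I.Dom M K)
    (hd : I.dU M = I.dU K) (hne : M ≠ K)
    (he : I.EliminatesSet M (I.rotClosure (I.rotationsAt M (I.dW M)) \ I.past M) M') :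
    I.Dom M' K ∧ I.dU M' = I.dU M ∧ I.dW M' < I.dW M := by
  have hK := hT.isStable
  have hM' := he.isStable hM
  -- Equal man-degrees and equal woman-degrees would give `M` the regret of `K`, against the choice
  -- of `K`.
  have hlt : I.dW K < I.dW M := by
    refine lt_of_le_of_ne (h.dW_le hM hK) fun heq => ?_
    have := hT.regret_lt M hM h hne
    rw [regret, regret, hd, heq] at this
    exact this.ne rfl
  have hnot : ∀ {m w}, I.rankW w m = I.dW M → (m, w) ∉ K := fun hr hk => by
    have := le_dW (I := I) hk
    omega
  have hsub : I.rotationsAt M (I.dW M) ⊆ I.past K := by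
    rintro σ ⟨hσ, m, w, h1, h2, h3⟩
    exact mem_past_of_manWould hK hσ h1 (h.manWould hK h2 (hnot h3))
  have hdom : I.Dom M' K := by
    refine dom_of_past_subset hM' hK ?_
    rw [he.past_eq]
    exact Set.union_subset (h.past_subset hM hK)
      (Set.sdiff_subset.trans (rotClosure_subset_past hK hsub))
  refine ⟨hdom, le_antisymm ?_ ((he.dom hM).dU_le hM hM'), ?_⟩
  · rw [hd]
    exact hdom.dU_le hM' hK
  -- A woman still at rank `dW M` would have kept her partner. That pair is not in `K`, so it lies
  -- in a rotation of `rotationsAt M (dW M)`, which has just been eliminated.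
  · rw [dW, Finset.sup_lt_iff (by rw [bot_eq_zero]; omega)]
    rintro ⟨m, w⟩ hw
    obtain ⟨x, hx⟩ := hM'.woman_assigned hM hw
    have h1 := (he.dom hM).women hM hM' hx hw
    have h2 := le_dW (I := I) hx
    refine lt_of_le_of_ne (h1.trans h2) fun heq => ?_
    have heq' : I.rankW w m = I.dW M := heq
    obtain rfl := rankW_injOn (hM'.1.acceptable _ _ hw).2 (h1.antisymm (heq' ▸ h2))
    obtain ⟨σ, h3, h4⟩ := exists_mem_past hM hK h hx (hnot heq')
    refine notMem_past_of_mem (I := I) hw h4 ?_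
    rw [he.past_eq, Set.union_sdiff_self]
    exact Or.inr (subset_rotClosure ⟨h3.1, m, w, h4, hx, heq'⟩)

/-- The while loop for `m`, being at `M`, is on its way to the column of `N`. -/
def Approaches (I : SMI U W) (N : Finset (U × W)) (m : U) (M : Finset (U × W)) : Prop :=
  I.Dom M N ∧ ∃ w, (m, w) ∈ N ∧ (m, w) ∉ M ∧ I.rankU m w = I.dU N

/-- The while loop cannot stop early. If `m` already had his partner in `M_z`, he would have the
same partner in `N`, which lies in between; and `dU < dW` holds strictly above `K`. -/
theorem IsTarget.guard (hT : I.IsTarget K N) (hM : I.IsStable M) (h : I.Approaches N m M) :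
    I.Guard m M := by
  obtain ⟨hd, w, hw, hwM, -⟩ := h
  have hN := hT.isStable'
  obtain ⟨x, hx⟩ := hN.man_assigned hM hw
  refine ⟨⟨x, hx, fun hz => hwM ?_⟩, ?_⟩
  · exact hM.1.mem_of_rankU_eq hx
      ((hd _ _ _ hx hw).antisymm (dom_wgs hN _ _ _ hw hz))
  · refine hT.dU_lt_dW hM (hd.trans hN hM hT.dom) fun he => hwM ?_
    subst he
    rwa [hd.antisymm hM hN hT.dom]

theorem IsTarget.while_step (hT : I.IsTarget K N) (hM : I.IsStable M) (h : I.Approaches N m M)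
    (hw : (m, w) ∈ M) (hφ : I.IsPhi m w ρ)
    (he : I.EliminatesSet M (I.rotClosure {ρ} \ I.past M) M') :
    I.Approaches N m M' ∨
      I.NewColumn (I.dU M) m M' ∧ I.Dom M' K ∧ I.dU M' = I.dU K := by
  obtain ⟨hd, x, hx, hxM, hr⟩ := h
  have hN := hT.isStable'
  have hM' := he.isStable hM
  have hwN : (m, w) ∉ N := fun h => hxM (hN.1.man_unique _ _ _ hx h ▸ hw)
  have hρ : ρ ∈ I.past N := mem_past_of_manWould hN hφ.1 hφ.2.1 (hd.manWould hN hw hwN)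
  have hdom : I.Dom M' N := by
    refine dom_of_past_subset hM' hN ?_
    rw [he.past_eq]
    exact Set.union_subset (hd.past_subset hM hN)
      (Set.sdiff_subset.trans (rotClosure_subset_past hN (Set.singleton_subset_iff.2 hρ)))
  by_cases hxM' : (m, x) ∈ M'
  · have hdU : I.dU M' = I.dU N := (hdom.dU_le hM' hN).antisymm (hr ▸ le_dU hxM')
    refine Or.inr ⟨⟨?_, x, hxM', hr.trans hdU.symm⟩, hdom.trans hN hM' hT.dom,
      hdU.trans hT.dU_eq⟩
    rw [hdU]
    -- The old matching was strictly above `N`, so its man-degree was smaller. This is why the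
    -- search aims at `N` rather than at `K`: above `K` another man could already have raised the
    -- man-degree to `dU K`.
    exact hT.dU_lt M hM hd fun h => hxM (h ▸ hx)
  · exact Or.inl ⟨hdom, x, hx, hxM', hr⟩

/-- The man `m` has the largest rank in `N`, and the column of `N` is not the first one. -/
def IsWitness (I : SMI U W) (N : Finset (U × W)) (m : U) : Prop :=
  I.dU I.mgs < I.dU N ∧ ∃ w, (m, w) ∈ N ∧ I.rankU m w = I.dU N

theorem exists_isWitness (h : I.dU I.mgs < I.dU N) : ∃ m, I.IsWitness N m := by
  have hne : N.Nonempty := by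
    rw [Finset.nonempty_iff_ne_empty]
    rintro rfl
    simp [dU] at h
  obtain ⟨⟨m, w⟩, hp, he⟩ := Finset.exists_mem_eq_sup N hne fun p => I.rankU p.1 p.2
  exact ⟨m, h, w, hp, he.symm⟩

theorem IsWitness.approaches (hN : I.IsStable N) (h : I.IsWitness N m) :
    I.Approaches N m I.mgs := by
  obtain ⟨hlt, w, hw, hr⟩ := h
  exact ⟨dom_mgs hN, w, hw, fun hw' => absurd hlt (hr ▸ le_dU hw').not_gt, hr⟩

/-! ### Invariants of the algorithm -/

/-- The local variables of the caller of the column operation are consistent. -/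
def FrameOk (I : SMI U W) : Frame U W → Prop
  | .first => True
  | .inner _ _ M Q => I.IsStable M ∧ Q = I.past M

/-- After the return from the column operation, the algorithm will still reach the column
of `N`. -/
def FramePending (I : SMI U W) (N : Finset (U × W)) : Frame U W → Prop
  | .first => ∃ m, I.IsWitness N m
  | .inner todo m M _ => (∃ x ∈ todo, I.IsWitness N x) ∨ I.Approaches N m M

/-- The invariant: the matchings are stable, `Q` is the set of eliminated rotations, and the best
matching so far is optimal or the algorithm will still find `K`. -/
def Inv (I : SMI U W) (K N : Finset (U × W)) : State U W → Prop
  | .start => True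
  | .col k a M Q Mopt => I.FrameOk k ∧ I.IsStable M ∧ Q = I.past M ∧ a = I.dU M ∧
      I.IsStable Mopt ∧ (I.regret Mopt ≤ I.regret K ∨ I.Dom M K ∧ I.dU M = I.dU K ∨
        I.FramePending N k)
  | .colRet k Mopt => I.FrameOk k ∧ I.IsStable Mopt ∧
      (I.regret Mopt ≤ I.regret K ∨ I.FramePending N k)
  | .forLoop todo Mopt => I.IsStable Mopt ∧
      (I.regret Mopt ≤ I.regret K ∨ ∃ x ∈ todo, I.IsWitness N x)
  | .whileLoop todo m M Q Mopt => I.IsStable M ∧ Q = I.past M ∧ I.IsStable Mopt ∧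
      (I.regret Mopt ≤ I.regret K ∨ (∃ x ∈ todo, I.IsWitness N x) ∨ I.Approaches N m M)
  | .output M => I.IsStable M ∧ I.regret M ≤ I.regret K

theorem Inv.step (hT : I.IsTarget K N) {s s' : State U W} (hs : I.Inv K N s)
    (h : I.Step s s') : I.Inv K N s' := by
  have hK := hT.isStable
  have hN := hT.isStable'
  have hcol : ∀ {k : Frame U W} {M M' Mopt : Finset (U × W)}, I.IsStable M →
      (I.regret Mopt ≤ I.regret K ∨ I.Dom M K ∧ I.dU M = I.dU K ∨ I.FramePending N k) →
      (I.EliminatesSet M (I.rotClosure (I.rotationsAt M (I.dW M)) \ I.past M) M') →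
      I.regret (I.better M Mopt) ≤ I.regret K ∨
        (I.Dom M' K ∧ I.dU M' = I.dU K ∧ I.dU M' = I.dU M ∧ I.dW M' < I.dW M) ∨
        I.FramePending N k := by
    rintro k M M' Mopt hM (h | ⟨h, hd⟩ | h) he
    · exact Or.inl ((regret_better_le_right _ _).trans h)
    -- Either the column operation stands at `K` and records a regret at least as good, or it moves
    -- on within the column of `K`.
    · by_cases hne : M = K
      · exact Or.inl (hne ▸ regret_better_le_left _ _)
      · obtain ⟨h1, h2, h3⟩ := hT.col_step hM h hd hne he
        exact Or.inr (Or.inl ⟨h1, h2.trans hd, h2, h3⟩)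
    · exact Or.inr (Or.inr h)
  cases h with
  | start_return h =>
    exact ⟨I.isStable_mgs, (dom_mgs hK).regret_le I.isStable_mgs hK h⟩
  | start_col h =>
    refine ⟨trivial, I.isStable_mgs, I.past_mgs.symm, rfl, I.isStable_mgs, Or.inr ?_⟩
    rcases ((dom_mgs hK).dU_le I.isStable_mgs hK).eq_or_lt with he | hlt
    · exact Or.inl ⟨dom_mgs hK, he⟩
    · exact Or.inr (exists_isWitness (hT.dU_eq ▸ hlt))
  | col_stop k a M Q Mopt h =>
    obtain ⟨hk, hM, rfl, rfl, hopt, hg⟩ := hs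
    refine ⟨hk, hM.better hopt, ?_⟩
    rcases hg with hg | ⟨hg, -⟩ | hg
    · exact Or.inl ((regret_better_le_right _ _).trans hg)
    · exact Or.inl ((regret_better_le_left _ _).trans (hg.regret_le hM hK h))
    · exact Or.inr hg
  | col_reject k a M Q Mopt M' h he hr =>
    obtain ⟨hk, hM, rfl, rfl, hopt, hg⟩ := hs
    refine ⟨hk, hM.better hopt, ?_⟩
    rcases hcol hM hg he with hg | ⟨-, -, h1, h2⟩ | hg
    · exact Or.inl hg
    -- Contradiction: on the way to `K` the column operation keeps the man-degree and lowers the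
    -- woman-degree, so neither ground for rejection holds.
    · omega
    · exact Or.inr hg
  | col_accept k a M Q Mopt M' h he hr =>
    obtain ⟨hk, hM, rfl, rfl, hopt, hg⟩ := hs
    have hM' := he.isStable hM
    refine ⟨hk, hM', he.past_eq.symm, ?_, hM.better hopt, ?_⟩
    · have := (he.dom hM).dU_le hM hM'
      omega
    · rcases hcol hM hg he with hg | ⟨h1, h2, -⟩ | hg
      exacts [Or.inl hg, Or.inr (Or.inl ⟨h1, h2⟩), Or.inr (Or.inr hg)]
  | ret_return k Mopt h => exact ⟨hs.2.1, h ▸ abs_nonneg _⟩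
  | ret_first Mopt h =>
    obtain ⟨-, hopt, hg⟩ := hs
    exact ⟨hopt, hg.imp_right fun ⟨m, hm⟩ => ⟨m, Finset.mem_univ m, hm⟩⟩
  | ret_inner todo m M Q Mopt h =>
    obtain ⟨⟨hM, hQ⟩, hopt, hg⟩ := hs
    exact ⟨hM, hQ, hopt, hg⟩
  | for_end Mopt =>
    obtain ⟨hopt, hg⟩ := hs
    exact ⟨hopt, hg.resolve_right (by simp)⟩
  | for_next todo m Mopt hm =>
    obtain ⟨hopt, hg⟩ := hs
    refine ⟨I.isStable_mgs, I.past_mgs.symm, hopt, hg.imp_right ?_⟩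
    rintro ⟨x, hx, hw⟩
    by_cases hxm : x = m
    · exact Or.inr (hxm ▸ hw.approaches hN)
    · exact Or.inl ⟨x, Finset.mem_erase.2 ⟨hxm, hx⟩, hw⟩
  | while_end todo m M Q Mopt h =>
    obtain ⟨hM, -, hopt, hg⟩ := hs
    refine ⟨hopt, hg.imp_right fun hg => hg.resolve_right fun ha => h (hT.guard hM ha)⟩
  | while_col todo m w ρ M Q Mopt M' h hw hφ he hc =>
    obtain ⟨hM, rfl, hopt, hg⟩ := hs
    have hM' := he.isStable hM
    refine ⟨⟨hM', he.past_eq.symm⟩, hM', he.past_eq.symm, rfl, hopt, ?_⟩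
    rcases hg with hg | hg | hg
    · exact Or.inl hg
    · exact Or.inr (Or.inr (Or.inl hg))
    · rcases hT.while_step hM hg hw hφ he with h | ⟨-, h⟩
      exacts [Or.inr (Or.inr (Or.inr h)), Or.inr (Or.inl h)]
  | while_skip todo m w ρ M Q Mopt M' h hw hφ he hc =>
    obtain ⟨hM, rfl, hopt, hg⟩ := hs
    refine ⟨he.isStable hM, he.past_eq.symm, hopt, hg.imp_right (Or.imp_right fun hg => ?_)⟩
    exact (hT.while_step hM hg hw hφ he).resolve_right fun h => hc h.1

theorem Reachable.inv (hT : I.IsTarget K N) {s : State U W} (h : I.Reachable s) :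
    I.Inv K N s := by
  induction h with
  | refl => trivial
  | tail _ h ih => exact ih.step hT h

/-- The algorithm does not get stuck. -/
theorem Inv.progress {s : State U W} (hs : I.Inv K N s) :
    (∃ M, s = .output M) ∨ ∃ s', I.Step s s' := by
  cases s with
  | start =>
    rcases le_or_gt (I.dW I.mgs) (I.dU I.mgs) with h | h
    exacts [Or.inr ⟨_, .start_return h⟩, Or.inr ⟨_, .start_col h⟩]
  | col k a M Q Mopt =>
    obtain ⟨-, hM, rfl, rfl, -⟩ := hs
    rcases le_or_gt (I.dW M) (I.dU M) with h | h
    · exact Or.inr ⟨_, Step.col_stop k (I.dU M) M (I.past M) Mopt h⟩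
    · obtain ⟨M', hM'⟩ := exists_eliminatesSet hM (S := I.rotationsAt M (I.dW M)) fun _ h => h.1
      by_cases hr : I.dU M < I.dU M' ∨ I.dW M' = I.dW M
      exacts [Or.inr ⟨_, .col_reject _ _ _ _ _ _ h hM' hr⟩,
        Or.inr ⟨_, .col_accept _ _ _ _ _ _ h hM' hr⟩]
  | colRet k Mopt =>
    by_cases h : I.regret Mopt = 0
    · exact Or.inr ⟨_, .ret_return _ _ h⟩
    · cases k with
      | first => exact Or.inr ⟨_, .ret_first _ h⟩
      | inner todo m M Q => exact Or.inr ⟨_, .ret_inner _ _ _ _ _ h⟩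
  | forLoop todo Mopt =>
    rcases todo.eq_empty_or_nonempty with rfl | ⟨m, hm⟩
    exacts [Or.inr ⟨_, .for_end _⟩, Or.inr ⟨_, .for_next _ _ _ hm⟩]
  | whileLoop todo m M Q Mopt =>
    obtain ⟨hM, rfl, -⟩ := hs
    by_cases h : I.Guard m M
    · obtain ⟨⟨w, hw, hw'⟩, -⟩ := id h
      obtain ⟨ρ, hρ⟩ := exists_isPhi hM hw hw'
      obtain ⟨M', hM'⟩ := exists_eliminatesSet hM (Set.singleton_subset_iff.2 hρ.1)
      by_cases hc : I.NewColumn (I.dU M) m M'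
      exacts [Or.inr ⟨_, .while_col _ _ _ _ _ _ _ _ h hw hρ hM' hc⟩,
        Or.inr ⟨_, .while_skip _ _ _ _ _ _ _ _ h hw hρ hM' hc⟩]
    · exact Or.inr ⟨_, .while_end _ _ _ _ _ h⟩
  | output M => exact Or.inl ⟨M, rfl⟩

/-! ### Termination -/

/-- The number of rotations that are not in `Q`. -/
noncomputable def remaining (I : SMI U W) (Q : Set (Finset (U × W))) : ℕ := (I.rotations \ Q).ncard

/-- The outer two components of the termination measure during a column operation. -/
noncomputable def frameMeasure (I : SMI U W) : Frame U W → ℕ × ℕ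
  | .first => (Fintype.card U + 1, 0)
  | .inner todo _ _ Q => (todo.card, I.remaining Q + 1)

/-- The termination measure, ordered lexicographically. -/
noncomputable def stateMeasure (I : SMI U W) : State U W → ℕ ×ₗ ℕ ×ₗ ℕ
  | .start => toLex (Fintype.card U + 2, toLex (0, 0))
  -- The offsets order the states that share the first two components: the column loop has at least
  -- 2, its return 1, the while loop 0. The `+ 1` at `remaining` leaves room for the head of the for
  -- loop at 0.
  | .col k _ M _ _ => toLex ((I.frameMeasure k).1, toLex ((I.frameMeasure k).2, I.dW M + 2))
  | .colRet k _ => toLex ((I.frameMeasure k).1, toLex ((I.frameMeasure k).2, 1))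
  | .forLoop todo _ => toLex (todo.card, toLex (0, 1))
  | .whileLoop todo _ _ Q _ => toLex (todo.card, toLex (I.remaining Q + 1, 0))
  | .output _ => toLex (0, toLex (0, 0))

theorem lex_lt_iff {a b c a' b' c' : ℕ} :
    (toLex (a, toLex (b, c)) : ℕ ×ₗ ℕ ×ₗ ℕ) < toLex (a', toLex (b', c')) ↔
      a < a' ∨ a = a' ∧ (b < b' ∨ b = b' ∧ c < c') := by
  simp [Prod.Lex.toLex_lt_toLex]

/-- The rotation `ρ` is new, because its pair `(m, w)` is still in `M`. -/
theorem remaining_lt (hw : (m, w) ∈ M) (hφ : I.IsPhi m w ρ) :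
    I.remaining (I.past M ∪ (I.rotClosure {ρ} \ I.past M)) < I.remaining (I.past M) := by
  refine Set.ncard_lt_ncard ?_ (Set.toFinite _)
  refine (Set.ssubset_iff_of_subset (Set.sdiff_subset_sdiff_right Set.subset_union_left)).2
    ⟨ρ, ⟨hφ.1, notMem_past_of_mem hw hφ.2.1⟩, fun h => h.2 ?_⟩
  rw [Set.union_sdiff_self]
  exact Or.inr (subset_rotClosure rfl)

theorem Inv.stateMeasure_lt {s s' : State U W} (hs : I.Inv K N s) (h : I.Step s s') :
    I.stateMeasure s' < I.stateMeasure s := by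
  cases h with
  | start_return h | start_col h => simp [stateMeasure, frameMeasure, lex_lt_iff]
  | col_stop k a M Q Mopt h => simp [stateMeasure, lex_lt_iff]
  | col_reject k a M Q Mopt M' h he hr => simp [stateMeasure, lex_lt_iff]
  | col_accept k a M Q Mopt M' h he hr =>
    obtain ⟨-, hM, rfl, rfl, -⟩ := hs
    have := (he.dom hM).dW_le hM (he.isStable hM)
    refine lex_lt_iff.2 ?_
    omega
  | ret_return k =>
    refine lex_lt_iff.2 ?_
    omega
  | ret_first => exact lex_lt_iff.2 (Or.inl (Nat.lt_succ_self _))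
  | ret_inner => exact lex_lt_iff.2 (Or.inr ⟨rfl, Or.inr ⟨rfl, Nat.one_pos⟩⟩)
  | for_end => simp [stateMeasure, lex_lt_iff]
  | for_next todo m Mopt hm =>
    have := Finset.card_erase_lt_of_mem hm
    refine lex_lt_iff.2 ?_
    omega
  | while_end => simp [stateMeasure, lex_lt_iff]
  | while_col todo m w ρ M Q Mopt M' h hw hφ he hc =>
    obtain ⟨-, rfl, -⟩ := hs
    have := remaining_lt hw hφ
    exact lex_lt_iff.2 (Or.inr ⟨rfl, Or.inl (Nat.succ_lt_succ this)⟩)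
  | while_skip todo m w ρ M Q Mopt M' h hw hφ he hc =>
    obtain ⟨-, rfl, -⟩ := hs
    have := remaining_lt hw hφ
    refine lex_lt_iff.2 ?_
    omega

end SMI

theorem mainTheorem1 {U W : Type*} [Fintype U] [Fintype W] [DecidableEq U] [DecidableEq W]
    (I : SMI U W) :
    -- every output is a regret-equal stable matching
    (∀ M, I.Reachable (.output M) → I.IsRegretEqual M) ∧
    -- no execution gets stuck before it has produced an output
    (∀ s, I.Reachable s → (∃ M, s = .output M) ∨ ∃ s', I.Step s s') ∧
    -- no execution runs forever
    (¬ ∃ f : ℕ → SMI.State U W, f 0 = .start ∧ ∀ k, I.Step (f k) (f (k + 1))) := by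
  obtain ⟨K, N, hT⟩ := I.exists_isTarget
  refine ⟨fun M hM => ?_, fun s hs => (hs.inv hT).progress, ?_⟩
  · obtain ⟨h1, h2⟩ := hM.inv hT
    exact ⟨h1, fun M' hM' => h2.trans (hT.regret_le M' hM')⟩
  · rintro ⟨f, h0, hf⟩
    have hreach : ∀ k, I.Reachable (f k) := by
      intro k
      induction k with
      | zero => rw [h0]; exact .refl
      | succ k ih => exact ih.tail (hf k)
    exact not_strictAnti_of_wellFoundedLT (fun k => I.stateMeasure (f k))
      (strictAnti_nat_of_succ_lt fun k => ((hreach k).inv hT).stateMeasure_lt (hf k))
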